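/- Consider $K\ge 1$ arms. For each arm $k$ the (cost, reward) pairs $(X_{n,k},R_{n,k})$, $n\ge 1$, are i.i.d. with law $\mathcal N(\mu_k,\Sigma_k)$, where $\mu_k=(\mathbb E[X_{1,k}],\mathbb E[R_{1,k}])$ and $\Sigma_k$ is positive semidefinite, and the arms are independent. Let $r_k=\mathbb E[R_{1,k}]/\mathbb E[X_{1,k}]$, $r^*=\max_k r_k$, $\Delta_k=r^*-r_k$, $\omega_k=\mathrm{Cov}(X_{1,k},R_{1,k})/\mathrm{Var}(X_{1,k})$ (and $\omega_k=0$ if $\mathrm{Var}(X_{1,k})=0$), $V_k=\min_{\omega\in\mathbb R}\mathrm{Var}(R_{1,k}-\omega X_{1,k})$ and $\sigma_k^2=V_k+(r^*-\omega_k)^2\,\mathrm{Var}(X_{1,k})$. The covariance matrices $\Sigma_1,\dots,\Sigma_K$ are fixed and known to the controller; the means $\mu_1,\dots,\mu_K$ are unknown. Call $(\mu_1,\dots,\mu_K)$ allowed if $\mathbb E[X_{1,k}]>0$, $\mathbb E[R_{1,k}]\ge 0$ and $\omega_k\le r_k$ for all $k$. A policy $\pi$ chooses at each epoch $n$ an arm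 $I_n$ as a measurable function of the pairs $(X_{j,I_j},R_{j,I_j})$, $j<n$, observed before; the function does not depend on the means. Let $T_k^\pi(n)$ be the number of pulls of arm $k$ in the first $n$ epochs. For a budget $B>0$ let $N_\pi(B)=\inf\{n:\sum_{i=1}^n X_{i,I_i}>B\}$, $\mathrm{REW}_\pi(B)=\sum_{i=1}^{N_\pi(B)}R_{i,I_i}$ and $\mathrm{Reg}_\pi(B)=\sup_{\pi'}\mathbb E[\mathrm{REW}_{\pi'}(B)]-\mathbb E[\mathrm{REW}_\pi(B)]$, where $\pi'$ ranges over all policies (and may be chosen depending on the means and on $B$). The policy $\pi$ is consistent if, for all allowed means, $\mathbb E[T_k^\pi(n)]=o(n^\alpha)$ as $n\to\infty$ for every $\alpha>0$ and every $k$ with $r_k<r^*$. Let $\pi$ be a consistent policy and let $(\mu_1,\dots,\mu_K)$ be allowed means such that no arm $k$ with $\Delta_k>0$ satisfies $V_k=0$, $\omega_k=r_k$ and $\mathrm{Var}(X_{1,k})>0$ simultaneously (that is, if the cost of such an arm is random, then $R_{1,k}-r_kX_{1,k}$ is not almost surely zero). Then, for every $B>0$, $\mathrm{REW}_{\pi'}(B)$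 is integrable for every policy $\pi'$ and $\sup_{\pi'}\mathbb E[\mathrm{REW}_{\pi'}(B)]<\infty$, so that the regret is well defined, and $$\liminf_{B\to\infty}\frac{\mathrm{Reg}_\pi(B)}{\log B}\;\ge\;\sum_{k:\Delta_k>0}\frac{\sigma_k^2}{\mathbb E[X_{1,k}]\,\Delta_k}.$$ -/

import Mathlib

open MeasureTheory ProbabilityTheory Filter Topology Asymptotics

/-! Budget-constrained bandits with `K` arms whose (cost, reward) pairs are jointly Gaussian with
known covariance matrices and unknown means.  Epochs are numbered from `0`. -/

namespace BudgetedBandit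

/-- A (cost, reward) pair: coordinate `0` is the cost, coordinate `1` is the reward. -/
abbrev Outcome : Type := EuclideanSpace ℝ (Fin 2)

/-! ### One arm, with mean vector `m = (E[X], E[R])` and covariance matrix `C` of `(X, R)` -/

/-- The reward rate `r = E[R] / E[X]`. -/
noncomputable def rate (m : Outcome) : ℝ := m 1 / m 0

/-- The regression coefficient `ω = Cov(X, R) / Var(X)` (equal to `0` when `Var(X) = 0`, where any
value is a minimizer of `w ↦ Var(R - w X)`). -/
noncomputable def slope (C : Matrix (Fin 2) (Fin 2) ℝ) : ℝ := C 0 1 / C 0 0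

/-- `V(X, R) = min_w Var(R - w X) = Var(R) - ω² Var(X)`; see `isLeast_residualVar`. -/
noncomputable def residualVar (C : Matrix (Fin 2) (Fin 2) ℝ) : ℝ := C 1 1 - slope C ^ 2 * C 0 0

/-- The means allowed for an arm with known covariance matrix `C`: positive mean cost, nonnegative
mean reward, and regression coefficient at most the reward rate. -/
def meanSpace (C : Matrix (Fin 2) (Fin 2) ℝ) : Set Outcome :=
  {m | 0 < m 0 ∧ 0 ≤ m 1 ∧ slope C ≤ rate m}

/-- The variance of `R - w X` for a Gaussian pair. -/
theorem variance_sub_mul (m : Outcome) {C : Matrix (Fin 2) (Fin 2) ℝ} (hC : C.PosSemidef) (w : ℝ) :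
    Var[fun x : Outcome => x 1 - w * x 0; multivariateGaussian m C] =
      C 1 1 - 2 * w * C 0 1 + w ^ 2 * C 0 0 := by
  have hi : ∀ i : Fin 2, MemLp (fun x : Outcome => x i) 2 (multivariateGaussian m C) := fun i =>
    IsGaussian.memLp_dual _ (EuclideanSpace.proj (𝕜 := ℝ) i) 2 (by norm_num)
  have h0 := (hi 0).const_mul w
  rw [variance_fun_sub (hi 1) h0, variance_const_mul, covariance_const_mul_right,
    variance_eval_multivariateGaussian hC, variance_eval_multivariateGaussian hC,
    covariance_comm, covariance_eval_multivariateGaussian hC]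
  ring

/-- `residualVar C` is the least variance of `R - w X`. -/
theorem isLeast_residualVar (m : Outcome) {C : Matrix (Fin 2) (Fin 2) ℝ} (hC : C.PosSemidef) :
    IsLeast (Set.range fun w : ℝ =>
      Var[fun x : Outcome => x 1 - w * x 0; multivariateGaussian m C]) (residualVar C) := by
  simp only [variance_sub_mul m hC]
  have h00 : 0 ≤ C 0 0 := by
    rw [← variance_eval_multivariateGaussian (μ := m) hC 0]
    exact variance_nonneg _ _
  rcases h00.eq_or_lt with h | h
  · have h01 : C 0 1 = 0 := by
      by_contra hne
      have h1 := variance_nonneg (fun x : Outcome => x 1 - (C 1 1 + 1) / (2 * C 0 1) * x 0)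
        (multivariateGaussian m C)
      rw [variance_sub_mul m hC, ← h] at h1
      have h2 : 2 * ((C 1 1 + 1) / (2 * C 0 1)) * C 0 1 = C 1 1 + 1 := by field_simp
      rw [h2] at h1
      linarith
    simp [residualVar, ← h, h01, IsLeast, lowerBounds]
  · refine ⟨⟨slope C, ?_⟩, ?_⟩
    · simp only [slope, residualVar]
      field_simp
      ring
    · rintro _ ⟨w, rfl⟩
      have key : C 1 1 - 2 * w * C 0 1 + w ^ 2 * C 0 0 - residualVar C =
          (w - slope C) ^ 2 * C 0 0 := by
        simp only [slope, residualVar]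
        field_simp
        ring
      have := mul_nonneg (sq_nonneg (w - slope C)) h00
      simp only
      linarith

/-! ### The instance `(θ, C)`: arm `k` has mean vector `θ k` and covariance matrix `C k` -/

variable {K : ℕ}

/-- The table of samples: `s (n, k)` is the pair that arm `k` produces if it is pulled at
epoch `n`. -/
abbrev Samples (K : ℕ) : Type := ℕ × Fin K → Outcome

/-- The law of the samples: all pairs are independent, those of arm `k` have law
`N(θ k, C k)`. -/
noncomputable def law (θ : Fin K → Outcome) (C : Fin K → Matrix (Fin 2) (Fin 2) ℝ) :
    Measure (Samples K) :=
  Measure.infinitePi fun p : ℕ × Fin K => multivariateGaussian (θ p.2) (C p.2)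

/-- The optimal reward rate `r* = max_k r_k`. -/
noncomputable def bestRate (θ : Fin K → Outcome) : ℝ := ⨆ k, rate (θ k)

/-- The gap `Δ_k = r* - r_k`. -/
noncomputable def gap (θ : Fin K → Outcome) (k : Fin K) : ℝ := bestRate θ - rate (θ k)

/-- `σ_k² = V(X_k, R_k) + (r* - ω_k)² Var(X_k)`. -/
noncomputable def sigmaSq (θ : Fin K → Outcome) (C : Fin K → Matrix (Fin 2) (Fin 2) ℝ)
    (k : Fin K) : ℝ :=
  residualVar (C k) + (bestRate θ - slope (C k)) ^ 2 * C k 0 0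

/-! ### Policies -/

/-- A non-anticipating policy: for every epoch `n`, a measurable rule choosing the arm from the
`n` (cost, reward) pairs observed so far (the arms pulled so far are determined by these). -/
structure Policy (K : ℕ) where
  rule : (n : ℕ) → (Fin n → Outcome) → Fin K
  measurable_rule : ∀ n, Measurable (rule n)

namespace Policy

/-- The pairs observed during the first `n` epochs. -/
def history (π : Policy K) (s : Samples K) : (n : ℕ) → Fin n → Outcome
  | 0 => Fin.elim0
  | n + 1 => Fin.snoc (α := fun _ => Outcome) (history π s n)
      (s (n, π.rule n (history π s n)))

/-- The arm pulled at epoch `n`. -/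
def arm (π : Policy K) (s : Samples K) (n : ℕ) : Fin K := π.rule n (π.history s n)

/-- The pair observed at epoch `n`. -/
def outcome (π : Policy K) (s : Samples K) (n : ℕ) : Outcome := s (n, π.arm s n)

/-- The total cost of the first `n` epochs. -/
noncomputable def totalCost (π : Policy K) (s : Samples K) (n : ℕ) : ℝ :=
  ∑ i ∈ Finset.range n, π.outcome s i 0

/-- The number of pulls until the budget is depleted: the first `n` with total cost `> B`. -/
noncomputable def numPulls (π : Policy K) (B : ℝ) (s : Samples K) : ℕ :=
  sInf {n : ℕ | B < π.totalCost s n}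

/-- The cumulative reward under budget `B`, that of the last epoch included. -/
noncomputable def reward (π : Policy K) (B : ℝ) (s : Samples K) : ℝ :=
  ∑ i ∈ Finset.range (π.numPulls B s), π.outcome s i 1

/-- The number of pulls of arm `k` in the first `n` epochs. -/
def pulls (π : Policy K) (k : Fin K) (n : ℕ) (s : Samples K) : ℕ :=
  ((Finset.range n).filter fun i => π.arm s i = k).card

/-- The expected cumulative reward under budget `B`. -/
noncomputable def expReward (θ : Fin K → Outcome) (C : Fin K → Matrix (Fin 2) (Fin 2) ℝ)
    (π : Policy K) (B : ℝ) : ℝ :=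
  ∫ s, π.reward B s ∂law θ C

/-- The regret: the optimal expected reward over all policies for the budget `B` (the optimal
policy may depend on the instance and on `B`) minus that of `π`. -/
noncomputable def regret (θ : Fin K → Outcome) (C : Fin K → Matrix (Fin 2) (Fin 2) ℝ)
    (π : Policy K) (B : ℝ) : ℝ :=
  (⨆ π' : Policy K, expReward θ C π' B) - expReward θ C π B

/-- Consistency of a policy when the covariance matrices `C` are known and the means are not:
under all means that are allowed for `C`, the expected number of pulls of every suboptimal arm in
`n` epochs is `o(n ^ α)` for every `α > 0`. -/
def IsConsistent (C : Fin K → Matrix (Fin 2) (Fin 2) ℝ) (π : Policy K) : Prop :=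
  ∀ θ : Fin K → Outcome, (∀ k, θ k ∈ meanSpace (C k)) →
    ∀ k, 0 < gap θ k → ∀ α : ℝ, 0 < α →
      (fun n : ℕ => ∫ s, (π.pulls k n s : ℝ) ∂law θ C) =o[atTop] fun n : ℕ => (n : ℝ) ^ α

end Policy

end BudgetedBandit

/-! Since E[R_k] = r* E[X_k] − Δ_k E[X_k], Wald's identity gives E[REW(B)] = r* E[total cost] − Σ_k
Δ_k E[X_k] E[pulls of arm k before depletion]. The mean total cost is at least B, so always pulling
a best arm earns at least r* B. For any policy it exceeds B by at most δ log B for large B, for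
every δ > 0, because Gaussian costs have exponential moments of every order. Up to δ log B the
regret is therefore at least the cost-weighted number of suboptimal pulls
(`eventually_sum_sub_le_regret`).

These pulls are bounded below by a change of measure. Shifting the mean of arm k by C_k v is
absolutely continuous even for singular C_k, with information vᵀC_k v / 2 per pull. The direction v
= u(−r*, 1) is the cheapest one for raising E[R_k] − r* E[X_k]; the information is u²σ_k²/2, and arm
k becomes the unique best one as soon as u > Δ_k E[X_k]/σ_k². Consistency under both instances then
forces about (2σ_k²/(Δ_k E[X_k])²) log n pulls in n epochs (`eventually_log_le_integral_pulls`). The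
nondegeneracy hypothesis keeps the shifted mean cost positive, so that the shifted instance is
allowed.

Epochs are related to the budget by n = ⌊√B⌋: Markov's inequality alone shows that depletion before
epoch n costs only O(1) expected pulls. As log n ≈ (log B)/2, this uses up exactly the factor 2
above and leaves σ_k²/(E[X_k] Δ_k). -/

namespace BudgetedBandit

/-! ### Gaussian laws: exponential moments and mean shifts along the range of the covariance -/

section Gaussian

open Matrix

variable {ι : Type*} [Fintype ι] [DecidableEq ι] {C : Matrix ι ι ℝ}

theorem map_inner_multivariateGaussian (m t : EuclideanSpace ℝ ι) (hC : C.PosSemidef) :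
    (multivariateGaussian m C).map (fun x => inner ℝ t x) =
      gaussianReal (inner ℝ t m) (t.ofLp ⬝ᵥ C *ᵥ t.ofLp).toNNReal := by
  have h := IsGaussian.map_eq_gaussianReal (μ := multivariateGaussian m C) (innerSL ℝ t)
  have h1 : (multivariateGaussian m C)[innerSL ℝ t] = inner ℝ t m := by
    rw [(innerSL ℝ t).integral_comp_id_comm IsGaussian.integrable_id,
      integral_id_multivariateGaussian]
    rfl
  have h2 : Var[innerSL ℝ t; multivariateGaussian m C] = t.ofLp ⬝ᵥ C *ᵥ t.ofLp := by
    rw [← covarianceBilin_multivariateGaussian (μ := m) hC,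
      covarianceBilin_self IsGaussian.memLp_two_id]
    rfl
  rw [h1, h2] at h
  exact h

omit [DecidableEq ι] in
theorem quadForm_nonneg (hC : C.PosSemidef) (t : ι → ℝ) : 0 ≤ t ⬝ᵥ C *ᵥ t := by
  simpa using hC.dotProduct_mulVec_nonneg t

theorem mgf_inner_multivariateGaussian (m t : EuclideanSpace ℝ ι) (hC : C.PosSemidef) (s : ℝ) :
    mgf (fun x => inner ℝ t x) (multivariateGaussian m C) s =
      Real.exp (inner ℝ t m * s + (t.ofLp ⬝ᵥ C *ᵥ t.ofLp) * s ^ 2 / 2) := by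
  rw [mgf_gaussianReal (map_inner_multivariateGaussian m t hC),
    Real.coe_toNNReal _ (quadForm_nonneg hC _)]

theorem integrable_exp_inner (m t : EuclideanSpace ℝ ι) (hC : C.PosSemidef) (s : ℝ) :
    Integrable (fun x => Real.exp (s * inner ℝ t x)) (multivariateGaussian m C) := by
  rw [← mgf_pos_iff, mgf_inner_multivariateGaussian m t hC]
  exact Real.exp_pos _

/-- The log-likelihood ratio of `N(m + C v, C)` with respect to `N(m, C)`. -/
noncomputable def logRatio (m : EuclideanSpace ℝ ι) (C : Matrix ι ι ℝ) (v x : EuclideanSpace ℝ ι) :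
    ℝ :=
  inner ℝ v x - inner ℝ v m - (v.ofLp ⬝ᵥ C *ᵥ v.ofLp) / 2

omit [DecidableEq ι] in
@[fun_prop]
theorem measurable_logRatio (m : EuclideanSpace ℝ ι) (C : Matrix ι ι ℝ) (v : EuclideanSpace ℝ ι) :
    Measurable (logRatio m C v) := by
  unfold logRatio
  fun_prop

/-- Cameron–Martin formula. Comparing transforms instead of Lebesgue densities covers singular `C`:
exponential tilting by `v` turns the moment generating function of one Gaussian into that of the
other. -/
theorem multivariateGaussian_add_mulVec (m v : EuclideanSpace ℝ ι) (hC : C.PosSemidef) :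
    multivariateGaussian (m + WithLp.toLp 2 (C *ᵥ v.ofLp)) C =
      (multivariateGaussian m C).withDensity
        fun x => ENNReal.ofReal (Real.exp (logRatio m C v x)) := by
  set q := v.ofLp ⬝ᵥ C *ᵥ v.ofLp with hq
  have hint : Integrable (fun x => Real.exp (logRatio m C v x)) (multivariateGaussian m C) := by
    have := (integrable_exp_inner m v hC 1).mul_const (Real.exp (-(inner ℝ v m + q / 2)))
    refine this.congr (.of_forall fun x => ?_)
    simp only [← Real.exp_add, logRatio]
    congr 1
    ring
  have : IsFiniteMeasure ((multivariateGaussian m C).withDensity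
        fun x => ENNReal.ofReal (Real.exp (logRatio m C v x))) :=
    isFiniteMeasure_withDensity_ofReal hint.2
  refine Measure.ext_of_charFun (funext fun t => ?_)
  have hsym : t.ofLp ⬝ᵥ C *ᵥ v.ofLp = v.ofLp ⬝ᵥ C *ᵥ t.ofLp := by
    have hT : Cᵀ = C := show C.IsSymm by simpa using hC.1
    rw [dotProduct_mulVec, ← mulVec_transpose, hT, dotProduct_comm]
  have hmgf : mgf (fun x => inner ℝ t x) (multivariateGaussian (m + WithLp.toLp 2 (C *ᵥ v.ofLp)) C)
      = mgf (fun x => inner ℝ t x) ((multivariateGaussian m C).withDensity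
        fun x => ENNReal.ofReal (Real.exp (logRatio m C v x))) := by
    funext s
    rw [mgf_inner_multivariateGaussian _ t hC, mgf,
      integral_withDensity_eq_integral_toReal_smul (by fun_prop) (by simp)]
    have e : ∀ x, (ENNReal.ofReal (Real.exp (logRatio m C v x))).toReal •
        Real.exp (s * inner ℝ t x) =
        Real.exp (-(inner ℝ v m + q / 2)) * Real.exp (1 * inner ℝ (v + s • t) x) := by
      intro x
      rw [ENNReal.toReal_ofReal (Real.exp_pos _).le, smul_eq_mul, ← Real.exp_add, ← Real.exp_add,
        logRatio, inner_add_left, real_inner_smul_left]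
      congr 1
      ring
    simp_rw [e]
    rw [integral_const_mul]
    have h2 := mgf_inner_multivariateGaussian m (v + s • t) hC 1
    rw [mgf] at h2
    rw [h2, ← Real.exp_add]
    have e3 : inner ℝ t (WithLp.toLp 2 (C *ᵥ v.ofLp)) = t.ofLp ⬝ᵥ C *ᵥ v.ofLp := by
      simp [PiLp.inner_apply, dotProduct, mul_comm]
    congr 1
    simp only [inner_add_right, inner_add_left, real_inner_smul_left, WithLp.ofLp_add,
      WithLp.ofLp_smul, mulVec_add, mulVec_smul, add_dotProduct, dotProduct_add, smul_dotProduct,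
      dotProduct_smul, e3, hsym, smul_eq_mul, ← hq]
    ring
  -- Both moment generating functions are finite on the whole line, so they agree on the complex
  -- plane; at `Complex.I` they are the characteristic functions at `t`.
  have := eqOn_complexMGF_of_mgf hmgf (x := Complex.I) (by
    have : integrableExpSet (fun x => inner ℝ t x)
        (multivariateGaussian (m + WithLp.toLp 2 (C *ᵥ v.ofLp)) C) = Set.univ :=
      Set.eq_univ_of_forall fun s => integrable_exp_inner _ t hC s
    simp [this])
  simp only [complexMGF] at this
  simp only [charFun_apply]
  simpa [mul_comm, real_inner_comm] using this

theorem integrable_eval_multivariateGaussian (m : EuclideanSpace ℝ ι) (i : ι) :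
    Integrable (fun x : EuclideanSpace ℝ ι => x i) (multivariateGaussian m C) :=
  (IsGaussian.memLp_dual (multivariateGaussian m C) (EuclideanSpace.proj (𝕜 := ℝ) i) 1
    (by norm_num)).integrable le_rfl

theorem integral_eval_multivariateGaussian (m : EuclideanSpace ℝ ι) (i : ι) :
    ∫ x : EuclideanSpace ℝ ι, x i ∂multivariateGaussian m C = m i := by
  have := (EuclideanSpace.proj (𝕜 := ℝ) i).integral_comp_id_comm
    (IsGaussian.integrable_id (μ := multivariateGaussian m C))
  rw [integral_id_multivariateGaussian] at this
  exact this

theorem integrable_inner_multivariateGaussian (m v : EuclideanSpace ℝ ι) :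
    Integrable (fun x : EuclideanSpace ℝ ι => inner ℝ v x) (multivariateGaussian m C) :=
  (IsGaussian.memLp_dual (multivariateGaussian m C) (innerSL ℝ v) 1 (by norm_num)).integrable le_rfl

theorem integrable_logRatio (m v m' : EuclideanSpace ℝ ι) (C' : Matrix ι ι ℝ) :
    Integrable (logRatio m C v) (multivariateGaussian m' C') := by
  have := integrable_inner_multivariateGaussian (C := C') m' v
  exact (this.sub (integrable_const _)).sub (integrable_const _)

/-- Minus the Kullback–Leibler divergence of N(m, C) from N(m + C v, C): the information gained from
one pull. -/
theorem integral_logRatio (m v : EuclideanSpace ℝ ι) :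
    ∫ x, logRatio m C v x ∂multivariateGaussian m C = -((v.ofLp ⬝ᵥ C *ᵥ v.ofLp) / 2) := by
  have h0 := integrable_inner_multivariateGaussian (C := C) m v
  have h1 : ∫ x : EuclideanSpace ℝ ι, inner ℝ v x ∂multivariateGaussian m C = inner ℝ v m := by
    have := (innerSL ℝ v).integral_comp_id_comm
      (IsGaussian.integrable_id (μ := multivariateGaussian m C))
    rw [integral_id_multivariateGaussian] at this
    exact this
  simp only [logRatio]
  have h2 : Integrable (fun x : EuclideanSpace ℝ ι => inner ℝ v x - inner ℝ v m)
      (multivariateGaussian m C) := h0.sub (integrable_const _)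
  rw [integral_sub h2 (integrable_const _), integral_sub h0 (integrable_const _), h1]
  simp

theorem integrable_exp_eval (m : EuclideanSpace ℝ ι) (hC : C.PosSemidef) (i : ι) (s : ℝ) :
    Integrable (fun x : EuclideanSpace ℝ ι => Real.exp (s * x i)) (multivariateGaussian m C) := by
  simpa [EuclideanSpace.inner_single_left] using
    integrable_exp_inner m (EuclideanSpace.single i 1) hC s

theorem integral_exp_eval (m : EuclideanSpace ℝ ι) (hC : C.PosSemidef) (i : ι) (s : ℝ) :
    ∫ x : EuclideanSpace ℝ ι, Real.exp (s * x i) ∂multivariateGaussian m C =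
      Real.exp (m i * s + C i i * s ^ 2 / 2) := by
  simpa [mgf, EuclideanSpace.inner_single_left] using
    mgf_inner_multivariateGaussian m (EuclideanSpace.single i 1) hC s

end Gaussian

variable {K : ℕ}

instance (θ : Fin K → Outcome) (C : Fin K → Matrix (Fin 2) (Fin 2) ℝ) :
    IsProbabilityMeasure (law θ C) := by
  unfold law
  infer_instance

theorem map_eval_law (θ : Fin K → Outcome) (C : Fin K → Matrix (Fin 2) (Fin 2) ℝ)
    (p : ℕ × Fin K) :
    (law θ C).map (fun s => s p) = multivariateGaussian (θ p.2) (C p.2) :=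
  Measure.infinitePi_map_eval _ p

/-! ### Histories, and independence of the next pair from the past -/

namespace Policy

variable (π : Policy K)

theorem history_succ (s : Samples K) (n : ℕ) :
    π.history s (n + 1) = Fin.snoc (α := fun _ => Outcome) (π.history s n) (π.outcome s n) := rfl

theorem history_eq (s : Samples K) (n : ℕ) :
    π.history s n = fun i : Fin n => π.outcome s i := by
  induction n with
  | zero => exact funext fun i => i.elim0
  | succ n ih =>
    rw [history_succ]
    funext i
    refine Fin.lastCases ?_ (fun j => ?_) i
    · simp
    · simp [ih]

theorem history_congr {s s' : Samples K} {n : ℕ} (h : ∀ p : ℕ × Fin K, p.1 < n → s p = s' p) :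
    π.history s n = π.history s' n := by
  induction n with
  | zero => rfl
  | succ n ih =>
    have h1 := ih fun p hp => h p (by omega)
    rw [history_succ, history_succ, outcome, outcome, arm, arm, h1, h _ (by simp)]

@[fun_prop]
theorem measurable_history (n : ℕ) : Measurable fun s => π.history s n := by
  induction n with
  | zero => exact measurable_pi_iff.2 fun i => i.elim0
  | succ n ih =>
    have harm : Measurable fun s => π.arm s n := (π.measurable_rule n).comp ih
    have hout : Measurable fun s => π.outcome s n :=
      (measurable_from_prod_countable_right (f := fun q : Fin K × Samples K => q.2 (n, q.1))
        fun k => measurable_pi_apply (n, k)).comp (harm.prodMk measurable_id)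
    refine measurable_pi_iff.2 fun i => ?_
    refine Fin.lastCases ?_ (fun j => ?_) i
    · simpa [history_succ] using hout
    · simpa [history_succ, Function.comp_def] using (measurable_pi_apply j).comp ih

@[fun_prop]
theorem measurable_arm (n : ℕ) : Measurable fun s => π.arm s n :=
  (π.measurable_rule n).comp (π.measurable_history n)

/-- The information available before epoch `n`. -/
abbrev info (n : ℕ) : MeasurableSpace (Samples K) :=
  MeasurableSpace.comap (fun s => π.history s n) inferInstance

theorem info_le (n : ℕ) : π.info n ≤ (inferInstance : MeasurableSpace (Samples K)) :=
  (π.measurable_history n).comap_le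

theorem measurable_outcome_info {i n : ℕ} (h : i < n) :
    Measurable[π.info n] fun s => π.outcome s i := by
  have h1 : Measurable[π.info n] fun s => π.history s n := comap_measurable _
  have h2 := (measurable_pi_apply (⟨i, h⟩ : Fin n)).comp h1
  refine (congrArg (Measurable[π.info n]) (funext fun s => ?_)).mp h2
  simp [history_eq]

theorem measurable_history_info {i n : ℕ} (h : i ≤ n) :
    Measurable[π.info n] fun s => π.history s i := by
  simp only [history_eq]
  exact @measurable_pi_lambda _ _ _ (π.info n) _ _
    fun j => π.measurable_outcome_info (j.2.trans_le h)

theorem measurable_arm_info {i n : ℕ} (h : i ≤ n) :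
    Measurable[π.info n] fun s => π.arm s i :=
  (π.measurable_rule i).comp (π.measurable_history_info h)

/-- The history before epoch `n` reads only table entries of earlier epochs, and these are
independent of the entry `(n, k)`. -/
theorem indepFun_history (θ : Fin K → Outcome) (C : Fin K → Matrix (Fin 2) (Fin 2) ℝ)
    (n : ℕ) (k : Fin K) :
    IndepFun (fun s => π.history s n) (fun s : Samples K => s (n, k)) (law θ C) := by
  classical
  have h0 : iIndepFun (fun (p : ℕ × Fin K) (s : Samples K) => s p) (law θ C) :=
    iIndepFun_infinitePi (X := fun _ x => x) fun _ => measurable_id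
  have h1 := h0.indepFun_finset (Finset.range n ×ˢ Finset.univ) {(n, k)}
    (by simp) fun p => measurable_pi_apply p
  -- Completes the entries before epoch `n` to a full table by zeros; the history does not see the
  -- difference.
  let ext : ((Finset.range n ×ˢ (Finset.univ : Finset (Fin K)) : Finset (ℕ × Fin K)) → Outcome) →
      Samples K := fun r p =>
    if h : p ∈ Finset.range n ×ˢ (Finset.univ : Finset (Fin K)) then r ⟨p, h⟩ else 0
  have hext : Measurable ext := by
    refine measurable_pi_iff.2 fun p => ?_
    by_cases h : p ∈ Finset.range n ×ˢ (Finset.univ : Finset (Fin K))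
    · simpa only [ext, h, dite_true] using measurable_pi_apply _
    · simpa only [ext, h, dite_false] using measurable_const
  have h2 := h1.comp ((π.measurable_history n).comp hext)
    (measurable_pi_apply (⟨(n, k), by simp⟩ : ({(n, k)} : Finset (ℕ × Fin K))))
  refine (congrArg (IndepFun · _ (law θ C)) (funext fun s => ?_)).mp h2
  refine π.history_congr fun p hp => ?_
  simp [ext, hp]

/-- Given the past, the pair observed at epoch `n` has the law of the arm pulled. -/
theorem lintegral_history_outcome (θ : Fin K → Outcome) (C : Fin K → Matrix (Fin 2) (Fin 2) ℝ)
    {n : ℕ} {g : (Fin n → Outcome) × Outcome → ENNReal} (hg : Measurable g) :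
    ∫⁻ s, g (π.history s n, π.outcome s n) ∂law θ C =
      ∫⁻ s, ∫⁻ y, g (π.history s n, y) ∂multivariateGaussian (θ (π.arm s n)) (C (π.arm s n))
        ∂law θ C := by
  classical
  -- Splitting by the arm pulled replaces the random table index of the outcome by a fixed one, to
  -- which independence applies.
  let G : Fin K → (Fin n → Outcome) × Outcome → ENNReal := fun k q =>
    if π.rule n q.1 = k then g q else 0
  have hG : ∀ k, Measurable (G k) := fun k =>
    Measurable.ite (((π.measurable_rule n).comp measurable_fst) (measurableSet_singleton k)) hg
      measurable_const
  have hk : ∀ k, ∫⁻ s, G k (π.history s n, s (n, k)) ∂law θ C =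
      ∫⁻ s, ∫⁻ y, G k (π.history s n, y) ∂multivariateGaussian (θ k) (C k) ∂law θ C := by
    intro k
    have h1 := (indepFun_iff_map_prod_eq_prod_map_map (π.measurable_history n).aemeasurable
      (measurable_pi_apply (n, k)).aemeasurable).1 (π.indepFun_history θ C n k)
    rw [map_eval_law] at h1
    rw [← lintegral_map (μ := law θ C) (f := G k) (g := fun s => (π.history s n, s (n, k))) (hG k)
      (by fun_prop), h1, lintegral_prod _ (hG k).aemeasurable,
      lintegral_map (hG k).lintegral_prod_right' (π.measurable_history n)]
  calc ∫⁻ s, g (π.history s n, π.outcome s n) ∂law θ C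
      = ∫⁻ s, ∑ k, G k (π.history s n, s (n, k)) ∂law θ C := by
        refine lintegral_congr fun s => ?_
        simp [G, outcome, arm]
    _ = ∑ k, ∫⁻ s, G k (π.history s n, s (n, k)) ∂law θ C :=
        lintegral_finsetSum _ fun k _ => (hG k).comp (by fun_prop)
    _ = ∑ k, ∫⁻ s, ∫⁻ y, G k (π.history s n, y) ∂multivariateGaussian (θ k) (C k) ∂law θ C :=
        Finset.sum_congr rfl fun k _ => hk k
    _ = ∫⁻ s, ∑ k, ∫⁻ y, G k (π.history s n, y) ∂multivariateGaussian (θ k) (C k) ∂law θ C :=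
        (lintegral_finsetSum _ fun k _ =>
          (hG k).lintegral_prod_right'.comp (π.measurable_history n)).symm
    _ = _ := by
        refine lintegral_congr fun s => ?_
        rw [Finset.sum_eq_single (π.arm s n)]
        · simp [G, arm]
        · intro k _ hk
          have : π.rule n (π.history s n) ≠ k := fun h => hk h.symm
          simp [G, this]
        · simp

/-- The indicator of an event known before epoch `n` on which arm `k` is pulled is independent of
the pair produced by that arm. -/
theorem integral_indicator_outcome (θ : Fin K → Outcome) (C : Fin K → Matrix (Fin 2) (Fin 2) ℝ)
    {n : ℕ} {A : Set (Samples K)} (hA : MeasurableSet[π.info n] A) {f : Outcome → ℝ}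
    (hfm : Measurable f) (hf : ∀ k, Integrable f (multivariateGaussian (θ k) (C k))) :
    Integrable (A.indicator fun s => f (π.outcome s n)) (law θ C) ∧
      ∫ s, A.indicator (fun s => f (π.outcome s n)) s ∂law θ C =
        ∑ k, (law θ C).real (A ∩ {s | π.arm s n = k}) *
          ∫ x, f x ∂multivariateGaussian (θ k) (C k) := by
  classical
  obtain ⟨D, hD, rfl⟩ := hA
  let E : Fin K → Set (Fin n → Outcome) := fun k => D ∩ π.rule n ⁻¹' {k}
  have hE : ∀ k, MeasurableSet (E k) := fun k =>
    hD.inter (π.measurable_rule n (measurableSet_singleton k))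
  let u : Fin K → Samples K → ℝ := fun k s => (E k).indicator 1 (π.history s n)
  have hum : ∀ k, Measurable (u k) := fun k =>
    (measurable_one.indicator (hE k)).comp (π.measurable_history n)
  have hind : ∀ k, IndepFun (u k) (fun s => f (s (n, k))) (law θ C) := fun k =>
    (π.indepFun_history θ C n k).comp (measurable_one.indicator (hE k)) hfm
  have hu : ∀ k, Integrable (u k) (law θ C) := fun k => by
    refine Integrable.of_bound (hum k).aestronglyMeasurable 1 (.of_forall fun s => ?_)
    simp only [u, Set.indicator_apply]
    split_ifs <;> simp
  have hfk : ∀ k, Integrable (fun s : Samples K => f (s (n, k))) (law θ C) := fun k => by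
    have := map_eval_law θ C (n, k) ▸ hf k
    exact this.comp_measurable (measurable_pi_apply _)
  have hmul : ∀ k, Integrable (fun s => u k s * f (s (n, k))) (law θ C) := fun k =>
    (hind k).integrable_mul (hu k) (hfk k)
  have heq : ((fun s => π.history s n) ⁻¹' D).indicator (fun s => f (π.outcome s n)) =
      fun s => ∑ k, u k s * f (s (n, k)) := by
    funext s
    by_cases hs : π.history s n ∈ D
    · rw [Set.indicator_of_mem (by exact hs), Finset.sum_eq_single (π.arm s n)]
      · simp [u, E, hs, arm, outcome]
      · intro k _ hk
        have : π.rule n (π.history s n) ≠ k := fun h => hk h.symm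
        simp [u, E, this]
      · simp
    · rw [Set.indicator_of_notMem (by exact hs)]
      simp [u, E, hs]
  rw [heq]
  refine ⟨integrable_finsetSum _ fun k _ => hmul k, ?_⟩
  rw [integral_finsetSum _ fun k _ => hmul k]
  refine Finset.sum_congr rfl fun k _ => ?_
  rw [(hind k).integral_fun_mul_eq_mul_integral (hum k).aestronglyMeasurable
    (hfk k).aestronglyMeasurable]
  congr 1
  · have : u k = ((fun s => π.history s n) ⁻¹' E k).indicator 1 := rfl
    rw [this, integral_indicator_one ((π.measurable_history n) (hE k))]
    rfl
  · rw [← map_eval_law θ C (n, k), integral_map (measurable_pi_apply (n, k)).aemeasurable hfm.aestronglyMeasurable]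

end Policy

/-! ### Depletion of the budget and Wald's identity -/

/-- The exponent is −t(E[X_k] − Var(X_k) t/2), negative for small t > 0 because mean costs are
positive; finitely many arms allow a common t and ρ. -/
theorem exists_exp_decay [NeZero K] {θ : Fin K → Outcome} {C : Fin K → Matrix (Fin 2) (Fin 2) ℝ}
    (hθ : ∀ k, 0 < θ k 0) :
    ∃ t : ℝ, 0 < t ∧ ∃ ρ : ℝ, 0 ≤ ρ ∧ ρ < 1 ∧
      ∀ k, Real.exp (θ k 0 * (-t) + C k 0 0 * (-t) ^ 2 / 2) ≤ ρ := by
  have h1 : ∀ᶠ t : ℝ in 𝓝[>] 0, ∀ k, -θ k 0 + C k 0 0 * t / 2 < 0 := by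
    refine eventually_all.2 fun k => ?_
    have : Tendsto (fun t : ℝ => -θ k 0 + C k 0 0 * t / 2) (𝓝[>] 0) (𝓝 (-θ k 0)) := by
      have : Continuous fun t : ℝ => -θ k 0 + C k 0 0 * t / 2 := by fun_prop
      simpa using (this.tendsto 0).mono_left nhdsWithin_le_nhds
    exact this.eventually_lt_const (by linarith [hθ k])
  obtain ⟨t, ht, ht0⟩ := (h1.and self_mem_nhdsWithin).exists
  have ht0 : 0 < t := ht0
  obtain ⟨k₀, hk₀⟩ := Finite.exists_max fun k =>
    Real.exp (θ k 0 * (-t) + C k 0 0 * (-t) ^ 2 / 2)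
  refine ⟨t, ht0, _, (Real.exp_pos _).le, ?_, hk₀⟩
  rw [Real.exp_lt_one_iff]
  nlinarith [ht k₀]

namespace Policy

variable (π : Policy K)

theorem totalCost_succ (s : Samples K) (n : ℕ) :
    π.totalCost s (n + 1) = π.totalCost s n + π.outcome s n 0 :=
  Finset.sum_range_succ _ _

theorem totalCost_eq (s : Samples K) (n : ℕ) :
    π.totalCost s n = ∑ i : Fin n, π.history s n i 0 := by
  rw [totalCost, Finset.sum_range]
  simp [history_eq]

/-- Given the past, one more epoch multiplies the mean of exp(−t · cost) by at most ρ, whichever arm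
is chosen, so the bound does not depend on the policy. -/
theorem lintegral_exp_neg_totalCost_le {θ : Fin K → Outcome}
    {C : Fin K → Matrix (Fin 2) (Fin 2) ℝ} (hC : ∀ k, (C k).PosSemidef) {t ρ : ℝ}
    (hρ : ∀ k, Real.exp (θ k 0 * (-t) + C k 0 0 * (-t) ^ 2 / 2) ≤ ρ) (n : ℕ) :
    ∫⁻ s, ENNReal.ofReal (Real.exp (-t * π.totalCost s n)) ∂law θ C ≤ ENNReal.ofReal ρ ^ n := by
  induction n with
  | zero => simp [totalCost]
  | succ n ih =>
    have e1 : ∀ s, ENNReal.ofReal (Real.exp (-t * π.totalCost s (n + 1))) =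
        ENNReal.ofReal (Real.exp (-t * ∑ i : Fin n, π.history s n i 0)) *
          ENNReal.ofReal (Real.exp (-t * π.outcome s n 0)) := fun s => by
      rw [totalCost_succ, totalCost_eq, mul_add, Real.exp_add,
        ENNReal.ofReal_mul (Real.exp_pos _).le]
    simp_rw [e1]
    rw [π.lintegral_history_outcome θ C (g := fun q =>
      ENNReal.ofReal (Real.exp (-t * ∑ i : Fin n, q.1 i 0)) *
          ENNReal.ofReal (Real.exp (-t * q.2 0))) (by fun_prop), pow_succ]
    calc _ ≤ ∫⁻ s, ENNReal.ofReal (Real.exp (-t * π.totalCost s n)) * ENNReal.ofReal ρ ∂law θ C := by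
          refine lintegral_mono fun s => ?_
          rw [totalCost_eq]
          dsimp only
          rw [lintegral_const_mul _ (by fun_prop)]
          gcongr
          rw [← ofReal_integral_eq_lintegral_ofReal (integrable_exp_eval _ (hC _) 0 _)
            (.of_forall fun x => (Real.exp_pos _).le), integral_exp_eval _ (hC _)]
          exact ENNReal.ofReal_le_ofReal (hρ _)
      _ ≤ _ := by
          rw [lintegral_mul_const' _ _ ENNReal.ofReal_ne_top]
          gcongr

/-- The event that the budget `B` has not been exceeded by the first `n` epochs. -/
def alive (B : ℝ) (n : ℕ) : Set (Samples K) := {s | ∀ j ≤ n, π.totalCost s j ≤ B}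

theorem measurable_totalCost_info {j n : ℕ} (h : j ≤ n) :
    Measurable[π.info n] fun s => π.totalCost s j :=
  @Finset.measurable_fun_sum _ _ _ _ _ _ (π.info n) _ _ fun _ hi =>
    (EuclideanSpace.proj (𝕜 := ℝ) (0 : Fin 2)).measurable.comp
      (π.measurable_outcome_info ((Finset.mem_range.1 hi).trans_le h))

theorem measurable_totalCost (n : ℕ) : Measurable fun s => π.totalCost s n :=
  (π.measurable_totalCost_info le_rfl).mono (π.info_le n) le_rfl

theorem measurableSet_alive_info (B : ℝ) (n : ℕ) : MeasurableSet[π.info n] (π.alive B n) := by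
  have : π.alive B n = ⋂ j ∈ Finset.range (n + 1), {s | π.totalCost s j ≤ B} := by
    ext s
    simp [alive]
  rw [this]
  exact Finset.measurableSet_biInter _ fun j hj =>
    (π.measurable_totalCost_info (Nat.lt_succ_iff.1 (Finset.mem_range.1 hj))) measurableSet_Iic

/-- Chernoff bound: being alive at `n` forces exp(−t · cost) ≥ exp(−tB). -/
theorem law_alive_le {θ : Fin K → Outcome}
    {C : Fin K → Matrix (Fin 2) (Fin 2) ℝ} (hC : ∀ k, (C k).PosSemidef) {t ρ : ℝ} (ht : 0 < t)
    (hρ0 : 0 ≤ ρ) (hρ : ∀ k, Real.exp (θ k 0 * (-t) + C k 0 0 * (-t) ^ 2 / 2) ≤ ρ) (B : ℝ) (n : ℕ) :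
    (law θ C).real (π.alive B n) ≤ Real.exp (t * B) * ρ ^ n := by
  have hm : Measurable fun s => ENNReal.ofReal (Real.exp (-t * π.totalCost s n)) := by
    have := π.measurable_totalCost n
    fun_prop
  have h1 := mul_meas_ge_le_lintegral₀ (μ := law θ C) hm.aemeasurable
    (ENNReal.ofReal (Real.exp (-t * B)))
  have h2 : π.alive B n ⊆ {s | ENNReal.ofReal (Real.exp (-t * B)) ≤
      ENNReal.ofReal (Real.exp (-t * π.totalCost s n))} := fun s hs => by
    refine ENNReal.ofReal_le_ofReal (Real.exp_le_exp.2 ?_)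
    nlinarith [hs n le_rfl]
  have h3 : ENNReal.ofReal (Real.exp (-t * B)) * law θ C (π.alive B n) ≤ ENNReal.ofReal ρ ^ n :=
    (mul_le_mul_right (measure_mono h2) _).trans
      (h1.trans (π.lintegral_exp_neg_totalCost_le hC hρ n))
  rw [← ENNReal.ofReal_pow hρ0] at h3
  have h4 := ENNReal.toReal_mono ENNReal.ofReal_ne_top h3
  rw [ENNReal.toReal_mul, ENNReal.toReal_ofReal (Real.exp_pos _).le,
    ENNReal.toReal_ofReal (pow_nonneg hρ0 _)] at h4
  have h5 : Real.exp (t * B) * Real.exp (-t * B) = 1 := by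
    rw [← Real.exp_add]
    simp
  calc (law θ C).real (π.alive B n)
      = Real.exp (t * B) * (Real.exp (-t * B) * (law θ C).real (π.alive B n)) := by
        rw [← mul_assoc, h5, one_mul]
    _ ≤ _ := by
        gcongr
        exact h4

/-- Costs may be negative, so survival must be required at every earlier epoch. The hypothesis
excludes the default value `sInf ∅ = 0`, which would count a never depleted budget as zero pulls. -/
theorem lt_numPulls_iff {B : ℝ} {s : Samples K} (hs : ∃ n, B < π.totalCost s n) (i : ℕ) :
    i < π.numPulls B s ↔ s ∈ π.alive B i := by
  constructor
  · intro h j hj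
    by_contra! hlt
    exact absurd (Nat.sInf_le (s := {n | B < π.totalCost s n}) hlt) (by
      unfold numPulls at h
      omega)
  · intro h
    by_contra! hle
    exact absurd (Nat.sInf_mem (s := {n | B < π.totalCost s n}) hs) (not_lt.2 (h _ hle))

variable [NeZero K] {θ : Fin K → Outcome} {C : Fin K → Matrix (Fin 2) (Fin 2) ℝ}

theorem ae_exists_lt_totalCost (hC : ∀ k, (C k).PosSemidef) (hθ : ∀ k, 0 < θ k 0) (B : ℝ) :
    ∀ᵐ s ∂law θ C, ∃ n, B < π.totalCost s n := by
  obtain ⟨t, ht, ρ, hρ0, hρ1, hρ⟩ := exists_exp_decay (C := C) hθ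
  have hsub : ∀ n, {s | ¬ ∃ n, B < π.totalCost s n} ⊆ π.alive B n := fun n s hs j _ =>
    not_lt.1 fun h => hs ⟨j, h⟩
  have hle : (law θ C).real {s | ¬ ∃ n, B < π.totalCost s n} ≤ 0 := by
    refine ge_of_tendsto' (x := atTop) (f := fun n : ℕ => Real.exp (t * B) * ρ ^ n) ?_ fun n =>
      (measureReal_mono (hsub n)).trans (π.law_alive_le hC ht hρ0 hρ B n)
    simpa using (tendsto_pow_atTop_nhds_zero_of_lt_one hρ0 hρ1).const_mul (Real.exp (t * B))
  have h0 := le_antisymm hle measureReal_nonneg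
  rwa [measureReal_eq_zero_iff] at h0

variable (θ C) in
/-- The expected number of pulls of arm `k` under the budget `B`. -/
noncomputable def expPulls (B : ℝ) (k : Fin K) : ℝ :=
  ∑' i, (law θ C).real (π.alive B i ∩ {s | π.arm s i = k})

theorem summable_expPulls (hC : ∀ k, (C k).PosSemidef) (hθ : ∀ k, 0 < θ k 0) (B : ℝ) (k : Fin K) :
    Summable fun i => (law θ C).real (π.alive B i ∩ {s | π.arm s i = k}) := by
  obtain ⟨t, ht, ρ, hρ0, hρ1, hρ⟩ := exists_exp_decay (C := C) hθ
  refine Summable.of_nonneg_of_le (fun _ => measureReal_nonneg) (fun i =>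
    (measureReal_mono Set.inter_subset_left).trans (π.law_alive_le hC ht hρ0 hρ B i)) ?_
  exact (summable_geometric_of_lt_one hρ0 hρ1).mul_left _

omit [NeZero K] in
theorem expPulls_nonneg (B : ℝ) (k : Fin K) : 0 ≤ π.expPulls θ C B k :=
  tsum_nonneg fun _ => measureReal_nonneg

/-- Wald's identity for the sum of `f` over the pairs observed under the budget `B`. -/
theorem integral_sum_range_numPulls (hC : ∀ k, (C k).PosSemidef) (hθ : ∀ k, 0 < θ k 0) (B : ℝ)
    {f : Outcome → ℝ} (hfm : Measurable f)
    (hf : ∀ k, Integrable f (multivariateGaussian (θ k) (C k))) :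
    Integrable (fun s => ∑ i ∈ Finset.range (π.numPulls B s), f (π.outcome s i)) (law θ C) ∧
      ∫ s, ∑ i ∈ Finset.range (π.numPulls B s), f (π.outcome s i) ∂law θ C =
        ∑ k, π.expPulls θ C B k * ∫ x, f x ∂multivariateGaussian (θ k) (C k) := by
  set F : ℕ → Samples K → ℝ := fun i => (π.alive B i).indicator fun s => f (π.outcome s i)
  have hF := fun i => π.integral_indicator_outcome θ C (π.measurableSet_alive_info B i) hfm hf
  have hFn := fun i => π.integral_indicator_outcome θ C (π.measurableSet_alive_info B i)
    hfm.norm fun k => (hf k).norm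
  have hnorm : ∀ i, ∫ s, ‖F i s‖ ∂law θ C =
      ∑ k, (law θ C).real (π.alive B i ∩ {s | π.arm s i = k}) *
        ∫ x, ‖f x‖ ∂multivariateGaussian (θ k) (C k) := fun i => by
    rw [← (hFn i).2]
    refine integral_congr_ae (.of_forall fun s => ?_)
    simp only [F, norm_indicator_eq_indicator_norm]
  have hsum : Summable fun i => ∫ s, ‖F i s‖ ∂law θ C := by
    simp_rw [hnorm]
    exact summable_sum fun k _ => (π.summable_expPulls hC hθ B k).mul_right _
  have hS := hasSum_integral_of_summable_integral_norm (fun i => (hF i).1) hsum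
  -- The stopped sum is almost surely a series of terms cut off by events known before each epoch;
  -- geometric decay of survival makes it absolutely convergent in mean.
  have hsupp : ∀ᵐ s ∂law θ C, HasSum (fun i => F i s)
      (∑ i ∈ Finset.range (π.numPulls B s), f (π.outcome s i)) := by
    filter_upwards [π.ae_exists_lt_totalCost hC hθ B] with s hs
    have h1 : ∑ i ∈ Finset.range (π.numPulls B s), f (π.outcome s i) =
        ∑ i ∈ Finset.range (π.numPulls B s), F i s := by
      refine Finset.sum_congr rfl fun i hi => ?_
      rw [Finset.mem_range, π.lt_numPulls_iff hs] at hi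
      exact (Set.indicator_of_mem hi fun s => f (π.outcome s i)).symm
    rw [h1]
    refine hasSum_sum_of_ne_finset_zero (f := fun i => F i s) fun i hi => ?_
    rw [Finset.mem_range, π.lt_numPulls_iff hs] at hi
    exact Set.indicator_of_notMem hi _
  constructor
  · refine ⟨aestronglyMeasurable_of_tendsto_ae atTop
      (f := fun n s => ∑ i ∈ Finset.range n, F i s) (fun n =>
        Finset.aestronglyMeasurable_fun_sum _ fun i _ => (hF i).1.1) ?_, ?_⟩
    · filter_upwards [hsupp] with s hs using hs.tendsto_sum_nat
    · calc ∫⁻ s, ‖∑ i ∈ Finset.range (π.numPulls B s), f (π.outcome s i)‖ₑ ∂law θ C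
          ≤ ∫⁻ s, ∑' i, ‖F i s‖ₑ ∂law θ C := by
            refine lintegral_mono_ae ?_
            filter_upwards [hsupp] with s hs
            rw [← hs.tsum_eq]
            exact enorm_tsum_le_tsum_enorm
        _ = ∑' i, ∫⁻ s, ‖F i s‖ₑ ∂law θ C := lintegral_tsum fun i => (hF i).1.1.enorm
        _ = ∑' i, ENNReal.ofReal (∫ s, ‖F i s‖ ∂law θ C) :=
            tsum_congr fun i => (ofReal_integral_norm_eq_lintegral_enorm (hF i).1).symm
        _ < ⊤ := hsum.tsum_ofReal_lt_top
  · have hae : (fun s => ∑' i, F i s) =ᵐ[law θ C]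
        fun s => ∑ i ∈ Finset.range (π.numPulls B s), f (π.outcome s i) := by
      filter_upwards [hsupp] with s hs using hs.tsum_eq
    rw [← integral_congr_ae hae, ← hS.tsum_eq]
    have hFi : ∀ i, ∫ s, F i s ∂law θ C = _ := fun i => (hF i).2
    rw [tsum_congr hFi]
    rw [Summable.tsum_finsetSum fun k _ => (π.summable_expPulls hC hθ B k).mul_right _]
    simp_rw [tsum_mul_right]
    rfl

/-! ### Mean total cost: the budget plus the overshoot -/

/-- The mean total cost exceeds the budget. -/
theorem le_sum_expPulls_mul (hC : ∀ k, (C k).PosSemidef) (hθ : ∀ k, 0 < θ k 0) (B : ℝ) :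
    B ≤ ∑ k, π.expPulls θ C B k * θ k 0 := by
  have h := π.integral_sum_range_numPulls hC hθ B (f := fun x => x 0) (by fun_prop)
    fun k => integrable_eval_multivariateGaussian _ _
  simp only [integral_eval_multivariateGaussian] at h
  rw [← h.2]
  have hc : ∫ _, B ∂law θ C = B := by simp
  refine hc.symm.trans_le (integral_mono_ae (integrable_const _) h.1 ?_)
  filter_upwards [π.ae_exists_lt_totalCost hC hθ B] with s hs
  exact (Nat.sInf_mem (s := {n | B < π.totalCost s n}) hs).le

/-- The mean total cost exceeds the budget only by the mean cost of the last epoch, which is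
controlled by an exponential moment. -/
theorem sum_expPulls_mul_le (hC : ∀ k, (C k).PosSemidef) (hθ : ∀ k, 0 < θ k 0) {B t a : ℝ}
    (hB : 0 < B) (ht : 0 < t) (ha : 0 < a) :
    ∑ k, π.expPulls θ C B k * θ k 0 ≤ B + 1 / t *
      ((∑ k, π.expPulls θ C B k * Real.exp (θ k 0 * t + C k 0 0 * t ^ 2 / 2)) / a +
        Real.log a - 1) := by
  have h := π.integral_sum_range_numPulls hC hθ B (f := fun x => x 0) (by fun_prop)
    fun k => integrable_eval_multivariateGaussian _ _
  have h' := π.integral_sum_range_numPulls hC hθ B (f := fun x => Real.exp (t * x 0))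
    (by fun_prop) fun k => integrable_exp_eval _ (hC k) _ _
  simp only [integral_eval_multivariateGaussian] at h
  simp only [integral_exp_eval _ (hC _)] at h'
  rw [← h.2, ← h'.2, ← integral_div]
  have e : ∀ I : ℝ, B + 1 / t * (I + Real.log a - 1) =
      1 / t * I + (B + 1 / t * (Real.log a - 1)) := fun I => by ring
  have hc : ∫ _, (B + 1 / t * (Real.log a - 1)) ∂law θ C = B + 1 / t * (Real.log a - 1) := by simp
  rw [e, ← integral_const_mul, ← hc, ← integral_add ((h'.1.div_const _).const_mul _)
    (integrable_const _)]
  refine integral_mono_ae h.1 (((h'.1.div_const _).const_mul _).add (integrable_const _)) ?_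
  filter_upwards [π.ae_exists_lt_totalCost hC hθ B] with s hs
  obtain ⟨n, hn⟩ : ∃ n, π.numPulls B s = n + 1 := by
    refine Nat.exists_eq_succ_of_ne_zero ?_
    have : 0 < π.numPulls B s := (π.lt_numPulls_iff hs 0).2 fun j hj => by
      simp [Nat.le_zero.1 hj, totalCost, hB.le]
    omega
  have hle : π.totalCost s n ≤ B := (π.lt_numPulls_iff hs n).1 (by omega) n le_rfl
  simp only [hn]
  -- The overshoot is at most the last cost, whose exponential is dominated by the sum over all
  -- epochs; Wald's identity applies to that sum.
  have hmem : Real.exp (t * π.outcome s n 0) ≤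
      ∑ i ∈ Finset.range (n + 1), Real.exp (t * π.outcome s i 0) :=
    Finset.single_le_sum (f := fun i => Real.exp (t * π.outcome s i 0))
      (fun i _ => (Real.exp_pos _).le) (by simp)
  -- The tangent bound log y ≤ y − 1 at y = exp(t x)/a linearizes the logarithm; `a` remains free.
  have hlog := Real.log_le_sub_one_of_pos (div_pos (Real.exp_pos (t * π.outcome s n 0)) ha)
  rw [Real.log_div (Real.exp_pos _).ne' ha.ne', Real.log_exp] at hlog
  have hdiv := div_le_div_of_nonneg_right hmem ha.le
  have hx : π.outcome s n 0 ≤ 1 / t *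
      ((∑ i ∈ Finset.range (n + 1), Real.exp (t * π.outcome s i 0)) / a + (Real.log a - 1)) := by
    rw [one_div, ← div_eq_inv_mul, le_div_iff₀ ht]
    linarith
  rw [Finset.sum_range_succ]
  change π.totalCost s n + _ ≤ _
  linarith

/-- The mean number of pulls is at most affine in the budget, uniformly over policies. -/
theorem exists_sum_expPulls_le (hC : ∀ k, (C k).PosSemidef) (hθ : ∀ k, 0 < θ k 0) :
    ∃ c : ℝ, 0 < c ∧ ∀ (π : Policy K) (B : ℝ), 0 < B →
      ∑ k, π.expPulls θ C B k ≤ c * (B + 1) := by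
  obtain ⟨k₀, hk₀⟩ := Finite.exists_min fun k => θ k 0
  obtain ⟨k₁, hk₁⟩ := Finite.exists_max fun k => Real.exp (θ k 0 * 1 + C k 0 0 * 1 ^ 2 / 2)
  set μ := θ k₀ 0
  set M := Real.exp (θ k₁ 0 * 1 + C k₁ 0 0 * 1 ^ 2 / 2)
  have hμ : 0 < μ := hθ k₀
  have hM : 0 < M := Real.exp_pos _
  -- With this `a` the exponential term is at most half of (number of pulls) · μ, hence is absorbed
  -- by the left side.
  set a := 2 * M / μ
  have ha : 0 < a := by positivity
  refine ⟨2 * (1 + |Real.log a|) / μ, by positivity, fun π B hB => ?_⟩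
  have h := π.sum_expPulls_mul_le hC hθ hB one_pos ha
  have h1 : (∑ k, π.expPulls θ C B k) * μ ≤ ∑ k, π.expPulls θ C B k * θ k 0 := by
    rw [Finset.sum_mul]
    exact Finset.sum_le_sum fun k _ => mul_le_mul_of_nonneg_left (hk₀ k) (π.expPulls_nonneg B k)
  have h2 : (∑ k, π.expPulls θ C B k * Real.exp (θ k 0 * 1 + C k 0 0 * 1 ^ 2 / 2)) / a ≤
      (∑ k, π.expPulls θ C B k) * μ / 2 := by
    rw [div_le_iff₀ ha]
    have : (∑ k, π.expPulls θ C B k) * μ / 2 * a = (∑ k, π.expPulls θ C B k) * M := by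
      simp only [a]
      field_simp
    rw [this, Finset.sum_mul]
    exact Finset.sum_le_sum fun k _ => mul_le_mul_of_nonneg_left (hk₁ k) (π.expPulls_nonneg B k)
  have h3 := le_abs_self (Real.log a)
  have h4 : (∑ k, π.expPulls θ C B k) * μ ≤ 2 * (1 + |Real.log a|) * (B + 1) := by
    nlinarith [mul_nonneg (abs_nonneg (Real.log a)) hB.le]
  rw [div_mul_eq_mul_div, le_div_iff₀ hμ]
  exact h4

theorem integrable_reward (hC : ∀ k, (C k).PosSemidef) (hθ : ∀ k, 0 < θ k 0) (B : ℝ) :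
    Integrable (π.reward B) (law θ C) :=
  (π.integral_sum_range_numPulls hC hθ B (f := fun x => x 1) (by fun_prop)
    fun k => integrable_eval_multivariateGaussian _ _).1

theorem expReward_eq (hC : ∀ k, (C k).PosSemidef) (hθ : ∀ k, 0 < θ k 0) (B : ℝ) :
    expReward θ C π B = ∑ k, π.expPulls θ C B k * θ k 1 := by
  have := (π.integral_sum_range_numPulls hC hθ B (f := fun x => x 1) (by fun_prop)
    fun k => integrable_eval_multivariateGaussian _ _).2
  simp only [integral_eval_multivariateGaussian] at this
  exact this

theorem bddAbove_expReward (hC : ∀ k, (C k).PosSemidef) (hθ : ∀ k, 0 < θ k 0) {B : ℝ}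
    (hB : 0 < B) : BddAbove (Set.range fun π : Policy K => π.expReward θ C B) := by
  obtain ⟨c, hc, h⟩ := exists_sum_expPulls_le (C := C) hC hθ
  obtain ⟨k₁, hk₁⟩ := Finite.exists_max fun k => |θ k 1|
  refine ⟨c * (B + 1) * |θ k₁ 1|, ?_⟩
  rintro _ ⟨π, rfl⟩
  simp only
  rw [π.expReward_eq hC hθ]
  calc ∑ k, π.expPulls θ C B k * θ k 1
      ≤ ∑ k, π.expPulls θ C B k * |θ k₁ 1| := Finset.sum_le_sum fun k _ =>
        mul_le_mul_of_nonneg_left ((le_abs_self _).trans (hk₁ k)) (π.expPulls_nonneg B k)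
    _ = (∑ k, π.expPulls θ C B k) * |θ k₁ 1| := (Finset.sum_mul _ _ _).symm
    _ ≤ _ := mul_le_mul_of_nonneg_right (h π B hB) (abs_nonneg _)

end Policy

/-! ### Change of measure and the logarithmic number of pulls -/

namespace Policy

variable (π : Policy K)

theorem pulls_eq_sum (k : Fin K) (n : ℕ) (s : Samples K) :
    (π.pulls k n s : ℝ) =
      ∑ i ∈ Finset.range n, {s | π.arm s i = k}.indicator (fun _ => (1 : ℝ)) s := by
  rw [pulls, Finset.card_filter, Nat.cast_sum]
  refine Finset.sum_congr rfl fun i _ => ?_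
  simp [Set.indicator_apply]

theorem measurable_pulls_info (k : Fin K) (n : ℕ) :
    Measurable[π.info n] fun s => (π.pulls k n s : ℝ) := by
  simp only [pulls_eq_sum]
  exact @Finset.measurable_fun_sum _ _ _ _ _ _ (π.info n) _ _ fun i hi =>
    (measurable_of_countable (({k} : Set (Fin K)).indicator fun _ => (1 : ℝ))).comp
      (π.measurable_arm_info (Finset.mem_range.1 hi).le)

theorem integrable_pulls (θ : Fin K → Outcome) (C : Fin K → Matrix (Fin 2) (Fin 2) ℝ)
    (k : Fin K) (n : ℕ) : Integrable (fun s => (π.pulls k n s : ℝ)) (law θ C) := by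
  refine Integrable.of_bound
    ((π.measurable_pulls_info k n).mono (π.info_le n) le_rfl).aestronglyMeasurable n
    (.of_forall fun s => ?_)
  rw [Real.norm_of_nonneg (Nat.cast_nonneg _)]
  exact_mod_cast (Finset.card_filter_le _ _).trans (Finset.card_range n).le

theorem integral_pulls (θ : Fin K → Outcome) (C : Fin K → Matrix (Fin 2) (Fin 2) ℝ)
    (k : Fin K) (n : ℕ) :
    ∫ s, (π.pulls k n s : ℝ) ∂law θ C =
      ∑ i ∈ Finset.range n, (law θ C).real {s | π.arm s i = k} := by
  have hm : ∀ i, MeasurableSet {s | π.arm s i = k} := fun i =>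
    π.measurable_arm i (measurableSet_singleton k)
  simp only [pulls_eq_sum]
  rw [integral_finsetSum _ fun i _ => (integrable_const (1 : ℝ)).indicator (hm i)]
  exact Finset.sum_congr rfl fun i _ => by simp [integral_indicator_const, hm i]

/-- The pulls of all arms add up to the number of epochs. -/
theorem sum_pulls (n : ℕ) (s : Samples K) : ∑ k, π.pulls k n s = n := by
  have := Finset.card_eq_sum_card_fiberwise (s := Finset.range n) (t := Finset.univ)
    (f := fun i => π.arm s i) (fun _ _ => Finset.mem_coe.2 (Finset.mem_univ _))
  rw [Finset.card_range] at this
  exact this.symm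

/-- The log-likelihood of the first `n` pairs when an observation `x` from arm `k` contributes
`ℓ k x`. -/
noncomputable def logLik (ℓ : Fin K → Outcome → ℝ) (n : ℕ) (s : Samples K) : ℝ :=
  ∑ i ∈ Finset.range n, ℓ (π.arm s i) (π.outcome s i)

theorem measurable_logLik_info {ℓ : Fin K → Outcome → ℝ} (hℓ : ∀ k, Measurable (ℓ k)) (n : ℕ) :
    Measurable[π.info n] (π.logLik ℓ n) := by
  refine @Finset.measurable_fun_sum _ _ _ _ _ _ (π.info n) _ _ fun i hi => ?_
  have hi := Finset.mem_range.1 hi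
  have h1 : Measurable[π.info n] fun s => (π.arm s i, π.outcome s i) :=
    (π.measurable_arm_info hi.le).prodMk (π.measurable_outcome_info hi)
  have h2 : Measurable fun q : Fin K × Outcome => ℓ q.1 q.2 :=
    measurable_from_prod_countable_right hℓ
  exact h2.comp h1

theorem measurable_snoc (n : ℕ) : Measurable fun q : (Fin n → Outcome) × Outcome =>
    (Fin.snoc (α := fun _ => Outcome) q.1 q.2 : Fin (n + 1) → Outcome) := by
  refine measurable_pi_iff.2 fun i => ?_
  refine Fin.lastCases ?_ (fun j => ?_) i
  · simpa using measurable_snd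
  · simpa [Function.comp_def] using (measurable_pi_apply j).comp
      (measurable_fst (α := Fin n → Outcome) (β := Outcome))

/-- Change of measure for functions of the first `n` observed pairs. -/
theorem lintegral_history_eq_mul_logLik {θ θ' : Fin K → Outcome}
    {C : Fin K → Matrix (Fin 2) (Fin 2) ℝ} {ℓ : Fin K → Outcome → ℝ} (hℓ : ∀ k, Measurable (ℓ k))
    (h : ∀ k, multivariateGaussian (θ' k) (C k) =
      (multivariateGaussian (θ k) (C k)).withDensity fun x => ENNReal.ofReal (Real.exp (ℓ k x)))
    {n : ℕ} {g : (Fin n → Outcome) → ENNReal} (hg : Measurable g) :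
    ∫⁻ s, g (π.history s n) ∂law θ' C =
      ∫⁻ s, g (π.history s n) * ENNReal.ofReal (Real.exp (π.logLik ℓ n s)) ∂law θ C := by
  induction n with
  | zero => simp [history, logLik]
  | succ n ih =>
    obtain ⟨L, hLm, hL⟩ := (π.measurable_logLik_info hℓ n).exists_eq_measurable_comp
    have hL' : ∀ s, π.logLik ℓ n s = L (π.history s n) := fun s => congrFun hL s
    set G : (Fin n → Outcome) × Outcome → ENNReal := fun q =>
      g (Fin.snoc (α := fun _ => Outcome) q.1 q.2)
    have hG : Measurable G := hg.comp (measurable_snoc n)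
    have hℓ2 : Measurable fun q : (Fin n → Outcome) × Outcome => ℓ (π.rule n q.1) q.2 :=
      (measurable_from_prod_countable_right (f := fun q : Fin K × Outcome => ℓ q.1 q.2) hℓ).comp
        (((π.measurable_rule n).comp measurable_fst).prodMk measurable_snd)
    set H : (Fin n → Outcome) × Outcome → ENNReal := fun q =>
      G q * (ENNReal.ofReal (Real.exp (L q.1)) *
        ENNReal.ofReal (Real.exp (ℓ (π.rule n q.1) q.2)))
    have e1 : ∀ s, g (π.history s (n + 1)) * ENNReal.ofReal (Real.exp (π.logLik ℓ (n + 1) s)) =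
        H (π.history s n, π.outcome s n) := by
      intro s
      have : π.logLik ℓ (n + 1) s = π.logLik ℓ n s + ℓ (π.arm s n) (π.outcome s n) :=
        Finset.sum_range_succ _ _
      rw [this, hL', Real.exp_add, ENNReal.ofReal_mul (Real.exp_pos _).le]
      rfl
    have e2 : ∀ s, g (π.history s (n + 1)) = G (π.history s n, π.outcome s n) := fun s => rfl
    simp_rw [e1, e2]
    rw [π.lintegral_history_outcome θ' C hG, π.lintegral_history_outcome θ C (g := H)
      (hG.mul ((hLm.comp measurable_fst).exp.ennreal_ofReal.mul hℓ2.exp.ennreal_ofReal))]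
    have hm : Measurable fun x : Fin n → Outcome => ∫⁻ y, G (x, y)
        ∂multivariateGaussian (θ' (π.rule n x)) (C (π.rule n x)) :=
      (measurable_from_prod_countable_right (f := fun q : Fin K × (Fin n → Outcome) =>
        ∫⁻ y, G (q.2, y) ∂multivariateGaussian (θ' q.1) (C q.1))
        fun k => hG.lintegral_prod_right' (ν := multivariateGaussian (θ' k) (C k))).comp ((π.measurable_rule n).prodMk measurable_id)
    -- The induction hypothesis is applied to the conditional mean of `G` given the first `n` pairs;
    -- the density of the last pair then supplies the missing factor.
    refine (ih hm).trans (lintegral_congr fun s => ?_)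
    have hGs : Measurable fun y => G (π.history s n, y) := hG.comp measurable_prodMk_left
    have hℓs : Measurable fun y => ENNReal.ofReal (Real.exp (ℓ (π.arm s n) y)) := by
      have := hℓ (π.arm s n)
      fun_prop
    change (∫⁻ y, G (π.history s n, y) ∂multivariateGaussian (θ' (π.arm s n)) (C (π.arm s n))) * _ =
      ∫⁻ y, G (π.history s n, y) * (ENNReal.ofReal (Real.exp (L (π.history s n))) *
          ENNReal.ofReal (Real.exp (ℓ (π.arm s n) y)))
        ∂multivariateGaussian (θ (π.arm s n)) (C (π.arm s n))
    rw [h, lintegral_withDensity_eq_lintegral_mul _ hℓs hGs, hL', mul_comm,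
      ← lintegral_const_mul _ (hℓs.mul hGs)]
    refine lintegral_congr fun y => ?_
    simp only [Pi.mul_apply]
    ring

/-- A lower bound on the sum of the two error probabilities of a test between two instances. -/
theorem exp_integral_logLik_le {θ θ' : Fin K → Outcome}
    {C : Fin K → Matrix (Fin 2) (Fin 2) ℝ} {ℓ : Fin K → Outcome → ℝ} (hℓ : ∀ k, Measurable (ℓ k))
    (h : ∀ k, multivariateGaussian (θ' k) (C k) =
      (multivariateGaussian (θ k) (C k)).withDensity fun x => ENNReal.ofReal (Real.exp (ℓ k x)))
    {n : ℕ} (hint : Integrable (π.logLik ℓ n) (law θ C)) {A : Set (Samples K)}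
    (hA : MeasurableSet[π.info n] A) :
    Real.exp (∫ s, π.logLik ℓ n s ∂law θ C - 1) ≤ (law θ C).real A + (law θ' C).real Aᶜ := by
  set W := π.logLik ℓ n
  have hWm : Measurable W := (π.measurable_logLik_info hℓ n).mono (π.info_le n) le_rfl
  have hAm : MeasurableSet A := π.info_le n _ hA
  have hone : ∫⁻ s, ENNReal.ofReal (Real.exp (W s)) ∂law θ C = 1 := by
    have := π.lintegral_history_eq_mul_logLik hℓ h (n := n) (g := fun _ => 1) measurable_const
    simpa using this.symm
  have hexp : Integrable (fun s => Real.exp (W s)) (law θ C) := by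
    refine ⟨by fun_prop, ?_⟩
    rw [hasFiniteIntegral_iff_ofReal (.of_forall fun s => (Real.exp_pos _).le), hone]
    exact ENNReal.one_lt_top
  have hexp1 : ∫ s, Real.exp (W s) ∂law θ C = 1 := by
    rw [integral_eq_lintegral_of_nonneg_ae (.of_forall fun s => (Real.exp_pos _).le) hexp.1, hone]
    simp
  have hA' : (law θ' C).real Aᶜ = ∫ s in Aᶜ, Real.exp (W s) ∂law θ C := by
    obtain ⟨D, hD, rfl⟩ := hA
    have := π.lintegral_history_eq_mul_logLik hℓ h (n := n) (g := Dᶜ.indicator 1)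
      (measurable_one.indicator hD.compl)
    have e1 : ∫⁻ s, Dᶜ.indicator 1 (π.history s n) ∂law θ' C =
        law θ' C ((fun s => π.history s n) ⁻¹' D)ᶜ := by
      rw [← lintegral_indicator_one hAm.compl]
      rfl
    have e2 : ∫⁻ s, Dᶜ.indicator 1 (π.history s n) * ENNReal.ofReal (Real.exp (W s)) ∂law θ C =
        ∫⁻ s in ((fun s => π.history s n) ⁻¹' D)ᶜ, ENNReal.ofReal (Real.exp (W s)) ∂law θ C := by
      rw [← lintegral_indicator hAm.compl]
      refine lintegral_congr fun s => ?_
      by_cases hs : π.history s n ∈ D <;> simp [hs]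
    rw [e1, e2] at this
    rw [integral_eq_lintegral_of_nonneg_ae (.of_forall fun s => (Real.exp_pos _).le)
      hexp.1.restrict, ← this]
    rfl
  have hmin : Integrable (fun s => min (W s) 0) (law θ C) := hint.inf (integrable_zero _ _ _)
  have hemin : Integrable (fun s => Real.exp (min (W s) 0)) (law θ C) := by
    refine Integrable.of_bound (by fun_prop) 1 (.of_forall fun s => ?_)
    rw [Real.norm_of_nonneg (Real.exp_pos _).le, Real.exp_le_one_iff]
    exact min_le_right _ _
  -- Pointwise min(W, 0) ≥ W − exp W, and exp W has mean 1.
  have h1 : ∫ s, W s ∂law θ C - 1 ≤ ∫ s, min (W s) 0 ∂law θ C := by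
    rw [← hexp1, ← integral_sub hint hexp]
    refine integral_mono (hint.sub hexp) hmin fun s => le_min ?_ ?_
    · simp only
      linarith [Real.exp_pos (W s)]
    · simp only
      linarith [Real.add_one_le_exp (W s)]
  -- Jensen's inequality bounds E[min(1, exp W)] from below; splitting that mean over A and its
  -- complement bounds it above by the two error probabilities.
  have h2 : Real.exp (∫ s, min (W s) 0 ∂law θ C) ≤ ∫ s, Real.exp (min (W s) 0) ∂law θ C :=
    convexOn_exp.map_integral_le Real.continuous_exp.continuousOn isClosed_univ (by simp) hmin hemin
  have h3 : ∫ s, Real.exp (min (W s) 0) ∂law θ C ≤ (law θ C).real A + (law θ' C).real Aᶜ := by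
    rw [← integral_add_compl hAm hemin, hA']
    refine add_le_add ?_ ?_
    · calc _ ≤ ∫ _ in A, (1 : ℝ) ∂law θ C :=
            integral_mono hemin.integrableOn (integrable_const _) fun s =>
              Real.exp_le_one_iff.2 (min_le_right _ _)
        _ = _ := by simp
    · exact integral_mono hemin.integrableOn hexp.integrableOn fun s =>
        Real.exp_le_exp.2 (min_le_left _ _)
  exact (Real.exp_le_exp.2 h1).trans (h2.trans h3)

open Matrix in
/-- The change of measure that shifts the mean of arm `k` along `C k v`. -/
theorem exp_neg_integral_pulls_le {θ : Fin K → Outcome}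
    {C : Fin K → Matrix (Fin 2) (Fin 2) ℝ} (hC : ∀ k, (C k).PosSemidef) (k : Fin K) (v : Outcome)
    {n : ℕ} {A : Set (Samples K)} (hA : MeasurableSet[π.info n] A) :
    Real.exp (-((v.ofLp ⬝ᵥ C k *ᵥ v.ofLp) / 2 * ∫ s, (π.pulls k n s : ℝ) ∂law θ C) - 1) ≤
      (law θ C).real A +
        (law (Function.update θ k (θ k + WithLp.toLp 2 (C k *ᵥ v.ofLp))) C).real Aᶜ := by
  set ℓ : Fin K → Outcome → ℝ := fun j => if j = k then logRatio (θ k) (C k) v else 0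
  have hℓ : ∀ j, Measurable (ℓ j) := fun j => by
    by_cases hj : j = k <;> simp only [ℓ, hj, if_true, if_false]
    · fun_prop
    · exact measurable_const
  have hterm := fun i => π.integral_indicator_outcome θ C (n := i)
    (π.measurable_arm_info le_rfl (measurableSet_singleton k))
    (measurable_logRatio (θ k) (C k) v) fun j => integrable_logRatio _ _ _ _
  have e : ∀ i, (fun s => ℓ (π.arm s i) (π.outcome s i)) =
      ((fun s => π.arm s i) ⁻¹' {k}).indicator
        fun s => logRatio (θ k) (C k) v (π.outcome s i) := fun i => by
    funext s
    by_cases hs : π.arm s i = k <;> simp [ℓ, hs]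
  have hi : ∀ i, Integrable (fun s => ℓ (π.arm s i) (π.outcome s i)) (law θ C) := fun i => by
    rw [e]
    exact (hterm i).1
  have hI : ∫ s, π.logLik ℓ n s ∂law θ C =
      -((v.ofLp ⬝ᵥ C k *ᵥ v.ofLp) / 2 * ∫ s, (π.pulls k n s : ℝ) ∂law θ C) := by
    simp only [logLik]
    rw [integral_finsetSum _ fun i _ => hi i, integral_pulls, Finset.mul_sum,
      ← Finset.sum_neg_distrib]
    refine Finset.sum_congr rfl fun i _ => ?_
    rw [e, (hterm i).2, Finset.sum_eq_single k]
    · rw [integral_logRatio]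
      have : (fun s => π.arm s i) ⁻¹' {k} ∩ {s | π.arm s i = k} = {s | π.arm s i = k} :=
        Set.inter_self _
      rw [this]
      ring
    · intro j _ hj
      have : (fun s => π.arm s i) ⁻¹' {k} ∩ {s | π.arm s i = j} = ∅ := by
        ext s
        simp only [Set.mem_inter_iff, Set.mem_preimage, Set.mem_singleton_iff]
        exact ⟨fun h => hj (h.2.symm.trans h.1), fun h => h.elim⟩
      rw [this]
      simp
    · simp
  rw [← hI]
  refine π.exp_integral_logLik_le hℓ (fun j => ?_) (integrable_finsetSum _ fun i _ => hi i) hA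
  by_cases hj : j = k
  · subst hj
    simpa [ℓ] using multivariateGaussian_add_mulVec (θ j) v (hC j)
  · simp [ℓ, hj]

open Matrix in
/-- A consistent policy pulls a suboptimal arm logarithmically often. -/
theorem eventually_log_le_integral_pulls {θ : Fin K → Outcome}
    {C : Fin K → Matrix (Fin 2) (Fin 2) ℝ} (hC : ∀ k, (C k).PosSemidef) (hπ : π.IsConsistent C)
    (hθ : ∀ k, θ k ∈ meanSpace (C k)) {k : Fin K} (hk : 0 < gap θ k) {v : Outcome}
    (hv : θ k + WithLp.toLp 2 (C k *ᵥ v.ofLp) ∈ meanSpace (C k))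
    (hbest : bestRate θ < rate (θ k + WithLp.toLp 2 (C k *ᵥ v.ofLp))) {α : ℝ} (hα : 0 < α) :
    ∀ᶠ n : ℕ in atTop, (1 - α) * Real.log n - 1 ≤
      (v.ofLp ⬝ᵥ C k *ᵥ v.ofLp) / 2 * ∫ s, (π.pulls k n s : ℝ) ∂law θ C := by
  classical
  set θ' := Function.update θ k (θ k + WithLp.toLp 2 (C k *ᵥ v.ofLp)) with hθ'
  have hk' : θ' k = θ k + WithLp.toLp 2 (C k *ᵥ v.ofLp) := by simp [θ']
  have hj' : ∀ j, j ≠ k → θ' j = θ j := fun j hj => by simp [θ', hj]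
  have hallow : ∀ j, θ' j ∈ meanSpace (C j) := fun j => by
    by_cases hj : j = k
    · subst hj
      rwa [hk']
    · rw [hj' j hj]
      exact hθ j
  have hgap : ∀ j, j ≠ k → 0 < gap θ' j := fun j hj => by
    have h1 : rate (θ' k) ≤ bestRate θ' := le_ciSup (f := fun i => rate (θ' i))
      (Set.finite_range _).bddAbove k
    have h2 : rate (θ j) ≤ bestRate θ := le_ciSup (f := fun i => rate (θ i))
      (Set.finite_range _).bddAbove j
    rw [gap, hj' j hj]
    rw [hk'] at h1
    linarith
  -- Arm `k` is suboptimal under θ and every other arm is suboptimal under θ', so consistency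
  -- applies to all these counts. The factor 2 comes from Markov's inequality at level n/2.
  have ho : (fun n : ℕ => 2 * (∫ s, (π.pulls k n s : ℝ) ∂law θ C +
      ∑ j ∈ Finset.univ.erase k, ∫ s, (π.pulls j n s : ℝ) ∂law θ' C)) =o[atTop]
      fun n : ℕ => (n : ℝ) ^ α :=
    ((hπ θ hθ k hk α hα).add ((IsLittleO.sum fun j hj =>
      hπ θ' hallow j (hgap j (Finset.ne_of_mem_erase hj)) α hα).congr_left fun n =>
        Finset.sum_apply _ _ _)).const_mul_left 2
  filter_upwards [ho.bound one_pos, eventually_gt_atTop 0] with n hn hn0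
  have hn0' : (0 : ℝ) < n := Nat.cast_pos.2 hn0
  rw [one_mul, Real.norm_of_nonneg (Real.rpow_nonneg hn0'.le _)] at hn
  replace hn := (le_abs_self _).trans hn
  -- The test for θ' against θ: whether arm `k` receives at least half of the pulls. Both errors
  -- together have probability at most n^(α − 1).
  set A : Set (Samples K) := {s | (n : ℝ) / 2 ≤ π.pulls k n s}
  have hA : MeasurableSet[π.info n] A := π.measurable_pulls_info k n measurableSet_Ici
  have hPA : (n : ℝ) / 2 * (law θ C).real A ≤ ∫ s, (π.pulls k n s : ℝ) ∂law θ C :=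
    mul_meas_ge_le_integral_of_nonneg (.of_forall fun s => Nat.cast_nonneg _)
      (π.integrable_pulls θ C k n) _
  have hPA' : (n : ℝ) / 2 * (law θ' C).real Aᶜ ≤
      ∑ j ∈ Finset.univ.erase k, ∫ s, (π.pulls j n s : ℝ) ∂law θ' C := by
    have hsub : Aᶜ ⊆ {s | (n : ℝ) / 2 ≤ ∑ j ∈ Finset.univ.erase k, (π.pulls j n s : ℝ)} := by
      intro s hs
      have hs : (π.pulls k n s : ℝ) < n / 2 := not_le.1 hs
      have h1 : ∑ j, (π.pulls j n s : ℝ) = n := by exact_mod_cast π.sum_pulls n s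
      rw [← Finset.add_sum_erase _ _ (Finset.mem_univ k)] at h1
      change (n : ℝ) / 2 ≤ _
      linarith
    rw [← integral_finsetSum _ fun j _ => π.integrable_pulls θ' C j n]
    exact (mul_le_mul_of_nonneg_left (measureReal_mono hsub) (by positivity)).trans
      (mul_meas_ge_le_integral_of_nonneg
        (.of_forall fun s => Finset.sum_nonneg fun j _ => Nat.cast_nonneg _)
        (integrable_finsetSum _ fun j _ => π.integrable_pulls θ' C j n) _)
  have hkl := π.exp_neg_integral_pulls_le (θ := θ) hC k v hA
  rw [← hθ'] at hkl
  have hle : Real.exp (-((v.ofLp ⬝ᵥ C k *ᵥ v.ofLp) / 2 *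
      ∫ s, (π.pulls k n s : ℝ) ∂law θ C) - 1) ≤ (n : ℝ) ^ (α - 1) := by
    refine hkl.trans ?_
    rw [Real.rpow_sub_one hn0'.ne', le_div_iff₀ hn0']
    linarith
  have := Real.log_le_log (Real.exp_pos _) hle
  rw [Real.log_exp, Real.log_rpow hn0'] at this
  linarith

end Policy

/-! ### The shifted mean vector: information and admissibility -/

theorem residualVar_nonneg {C : Matrix (Fin 2) (Fin 2) ℝ} (hC : C.PosSemidef) :
    0 ≤ residualVar C := by
  obtain ⟨w, hw⟩ := (isLeast_residualVar 0 hC).1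
  rw [← hw]
  exact variance_nonneg _ _

theorem slope_mul_self {C : Matrix (Fin 2) (Fin 2) ℝ} (hC : C.PosSemidef) :
    slope C * C 0 0 = C 0 1 := by
  by_cases h : C 0 0 = 0
  -- If Var(X) = 0, comparing the minimum of Var(R − wX) with its value at w = Cov(X, R) gives 2
  -- Cov(X, R)² ≤ 0.
  · have h1 : residualVar C ≤ _ := (isLeast_residualVar 0 hC).2 ⟨C 0 1, rfl⟩
    simp only [variance_sub_mul 0 hC, residualVar, h] at h1
    have h2 : C 0 1 = 0 := by nlinarith
    simp [h, h2]
  · simp [slope, h]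

theorem rate_le_bestRate (θ : Fin K → Outcome) (k : Fin K) : rate (θ k) ≤ bestRate θ :=
  le_ciSup (f := fun i => rate (θ i)) (Set.finite_range _).bddAbove k

theorem gap_nonneg (θ : Fin K → Outcome) (k : Fin K) : 0 ≤ gap θ k :=
  sub_nonneg.2 (rate_le_bestRate θ k)

theorem apply_one_eq {θ : Fin K → Outcome} {k : Fin K} (h : 0 < θ k 0) :
    θ k 1 = bestRate θ * θ k 0 - gap θ k * θ k 0 := by
  rw [gap, rate]
  field_simp
  ring

open Matrix in
-- The left side is Var(u(R − rX)); completing the square around the regression coefficient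
-- separates the residual variance. At r = r* the bracket is σ_k².
theorem dotProduct_mulVec_neg_bestRate {C : Matrix (Fin 2) (Fin 2) ℝ} (hC : C.PosSemidef)
    (r u : ℝ) :
    ![-(u * r), u] ⬝ᵥ C *ᵥ ![-(u * r), u] =
      u ^ 2 * (residualVar C + (r - slope C) ^ 2 * C 0 0) := by
  have h1 := slope_mul_self hC
  have h2 : C 1 0 = C 0 1 := by simpa using hC.1.apply 0 1
  simp only [dotProduct, mulVec, Fin.sum_univ_two, residualVar, h2, Matrix.cons_val_zero,
    Matrix.cons_val_one]
  linear_combination (-2 * u ^ 2 * r) * (-h1)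

open Matrix in
/-- The perturbed mean, for which arm `k` is the best one, is allowed. -/
theorem add_mulVec_mem_meanSpace {θ : Fin K → Outcome}
    {C : Fin K → Matrix (Fin 2) (Fin 2) ℝ} (hC : ∀ k, (C k).PosSemidef)
    (hθ : ∀ k, θ k ∈ meanSpace (C k)) {k : Fin K} {u : ℝ}
    (hu : gap θ k * θ k 0 < u * sigmaSq θ C k)
    (hu' : u * (bestRate θ - slope (C k)) * C k 0 0 < θ k 0) :
    θ k + WithLp.toLp 2 (C k *ᵥ ![-(u * bestRate θ), u]) ∈ meanSpace (C k) ∧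
      bestRate θ < rate (θ k + WithLp.toLp 2 (C k *ᵥ ![-(u * bestRate θ), u])) := by
  obtain ⟨h0, h1, h2⟩ := hθ k
  set r := bestRate θ
  have hs := slope_mul_self (hC k)
  have h10 : C k 1 0 = C k 0 1 := by simpa using (hC k).1.apply 0 1
  have hr : rate (θ k) ≤ r := rate_le_bestRate θ k
  have hr0 : 0 ≤ r := (div_nonneg h1 h0.le).trans hr
  set m := θ k + WithLp.toLp 2 (C k *ᵥ ![-(u * r), u])
  have e0 : m 0 = θ k 0 - u * (r - slope (C k)) * C k 0 0 := by
    simp only [m, PiLp.add_apply, mulVec, dotProduct, Fin.sum_univ_two, Matrix.cons_val_zero,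
      Matrix.cons_val_one]
    linear_combination -u * hs
  have e1 : m 1 = r * m 0 + (u * sigmaSq θ C k - gap θ k * θ k 0) := by
    rw [e0]
    simp only [m, PiLp.add_apply, mulVec, dotProduct, Fin.sum_univ_two, Matrix.cons_val_zero,
      Matrix.cons_val_one, apply_one_eq h0, sigmaSq, residualVar, h10]
    linear_combination u * r * hs
  have hm0 : 0 < m 0 := by linarith
  have hbest : r < rate m := by
    rw [rate, lt_div_iff₀ hm0]
    linarith
  -- The new reward exceeds r* ≥ 0 times the new cost, and the regression coefficient is at most r_k
  -- ≤ r*, which is below the new rate.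
  exact ⟨⟨hm0, by nlinarith, by linarith⟩, hbest⟩

/-- Positivity of the shifted mean cost at the critical size u = Δ_k E[X_k]/σ_k². The difference of
the two sides is V_k + (r* − ω_k)(r_k − ω_k) Var(X_k); with a random cost it could vanish only if
V_k = 0 and ω_k = r_k. -/
theorem mul_gap_lt_sigmaSq {θ : Fin K → Outcome}
    {C : Fin K → Matrix (Fin 2) (Fin 2) ℝ} (hC : ∀ k, (C k).PosSemidef)
    (hθ : ∀ k, θ k ∈ meanSpace (C k)) {k : Fin K} (hσ : 0 < sigmaSq θ C k) (hk : 0 < gap θ k)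
    (hnd : 0 < C k 0 0 → slope (C k) = rate (θ k) → 0 < residualVar (C k)) :
    (bestRate θ - slope (C k)) * C k 0 0 * gap θ k < sigmaSq θ C k := by
  have hV := residualVar_nonneg (hC k)
  have h2 := (hθ k).2.2
  have h00 : 0 ≤ C k 0 0 := (hC k).diag_nonneg
  rcases h00.eq_or_lt with h | h
  · rw [← h]
    simpa using hσ
  have hk' := hk
  unfold gap at hk
  have e : sigmaSq θ C k - (bestRate θ - slope (C k)) * C k 0 0 * gap θ k =
      residualVar (C k) + (bestRate θ - slope (C k)) * (rate (θ k) - slope (C k)) * C k 0 0 := by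
    unfold sigmaSq gap
    ring
  rw [← sub_pos, e]
  rcases h2.eq_or_lt with h3 | h3
  · have := hnd h h3
    rw [h3]
    simpa
  · have : 0 < (bestRate θ - slope (C k)) * (rate (θ k) - slope (C k)) * C k 0 0 :=
      mul_pos (mul_pos (by linarith) (by linarith)) h
    linarith

/-! ### From epochs to budget, and from pulls to regret -/

namespace Policy

variable [NeZero K] (π : Policy K) {θ : Fin K → Outcome} {C : Fin K → Matrix (Fin 2) (Fin 2) ℝ}

/-- If `n ^ 2 ≤ B`, the budget `B` is unlikely to be exceeded in the first `n` epochs, so that the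
expected number of pulls under `B` is at least that in `n` epochs, up to a constant. -/
theorem exists_integral_pulls_le_expPulls (hC : ∀ k, (C k).PosSemidef) (hθ : ∀ k, 0 < θ k 0) :
    ∃ c : ℝ, ∀ (B : ℝ) (n : ℕ), 0 < B → (n : ℝ) ^ 2 ≤ B → ∀ k,
      ∫ s, (π.pulls k n s : ℝ) ∂law θ C - c ≤ π.expPulls θ C B k := by
  set c := ∑ k, ∫ x : Outcome, |x 0| ∂multivariateGaussian (θ k) (C k)
  have habs : ∀ k, Integrable (fun x : Outcome => |x 0|) (multivariateGaussian (θ k) (C k)) :=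
    fun k => (integrable_eval_multivariateGaussian _ _).abs
  have hc0 : 0 ≤ c := Finset.sum_nonneg fun k _ => integral_nonneg fun x => abs_nonneg _
  have hout := fun i => π.integral_indicator_outcome θ C (n := i) (A := Set.univ)
    (@MeasurableSet.univ _ (π.info i)) (f := fun x => |x 0|) (by fun_prop) habs
  simp only [Set.indicator_univ, Set.univ_inter] at hout
  refine ⟨c, fun B n hB hn k => ?_⟩
  have hle : ∀ i, ∫ s, |π.outcome s i 0| ∂law θ C ≤ c := fun i => by
    rw [(hout i).2]
    exact Finset.sum_le_sum fun k _ => mul_le_of_le_one_left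
      (integral_nonneg fun x => abs_nonneg _) measureReal_le_one
  have hP : ∀ i ∈ Finset.range n, B * (law θ C).real (π.alive B i)ᶜ ≤ n * c := by
    intro i hi
    have hsub : (π.alive B i)ᶜ ⊆ {s | B ≤ ∑ l ∈ Finset.range n, |π.outcome s l 0|} := by
      intro s hs
      simp only [alive, Set.mem_compl_iff, Set.mem_ofPred_eq, not_forall, not_le] at hs
      obtain ⟨j, hj, hlt⟩ := hs
      refine hlt.le.trans ?_
      refine (Finset.sum_le_sum fun l _ => le_abs_self _).trans
        (Finset.sum_le_sum_of_subset_of_nonneg ?_ fun _ _ _ => abs_nonneg _)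
      exact Finset.range_subset_range.2 (hj.trans (Finset.mem_range.1 hi).le)
    calc B * (law θ C).real (π.alive B i)ᶜ
        ≤ ∫ s, ∑ l ∈ Finset.range n, |π.outcome s l 0| ∂law θ C :=
          (mul_le_mul_of_nonneg_left (measureReal_mono hsub) hB.le).trans
            (mul_meas_ge_le_integral_of_nonneg
              (.of_forall fun s => Finset.sum_nonneg fun _ _ => abs_nonneg _)
              (integrable_finsetSum _ fun l _ => (hout l).1) _)
      _ = ∑ l ∈ Finset.range n, ∫ s, |π.outcome s l 0| ∂law θ C :=
          integral_finsetSum _ fun l _ => (hout l).1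
      _ ≤ ∑ l ∈ Finset.range n, c := Finset.sum_le_sum fun l _ => hle l
      _ = n * c := by simp
  have hsum : ∑ i ∈ Finset.range n, (law θ C).real (π.alive B i ∩ {s | π.arm s i = k}) ≤
      π.expPulls θ C B k :=
    (π.summable_expPulls hC hθ B k).sum_le_tsum _ fun _ _ => measureReal_nonneg
  refine le_trans ?_ hsum
  rw [π.integral_pulls, sub_le_iff_le_add]
  have hterm : ∀ i ∈ Finset.range n, (law θ C).real {s | π.arm s i = k} ≤
      (law θ C).real (π.alive B i ∩ {s | π.arm s i = k}) + n * c / B := by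
    intro i hi
    have h1 : (law θ C).real (π.alive B i)ᶜ ≤ n * c / B := by
      rw [le_div_iff₀ hB, mul_comm]
      exact hP i hi
    have h2 : {s | π.arm s i = k} ⊆
        (π.alive B i ∩ {s | π.arm s i = k}) ∪ (π.alive B i)ᶜ := fun s hs => by
      by_cases h : s ∈ π.alive B i
      · exact Or.inl ⟨h, hs⟩
      · exact Or.inr h
    exact (measureReal_mono h2).trans ((measureReal_union_le _ _).trans (by linarith))
  refine (Finset.sum_le_sum hterm).trans ?_
  rw [Finset.sum_add_distrib]
  -- Here n² ≤ B enters: each of the n epochs loses at most n c / B by Markov's inequality.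
  have : ∑ i ∈ Finset.range n, n * c / B ≤ c := by
    rw [Finset.sum_const, Finset.card_range, nsmul_eq_mul, ← mul_div_assoc, div_le_iff₀ hB]
    nlinarith
  linarith

/-- Every suboptimal arm is pulled logarithmically often before the budget is depleted. -/
theorem eventually_mul_log_le_expPulls (hC : ∀ k, (C k).PosSemidef) (hπ : π.IsConsistent C)
    (hθ : ∀ k, θ k ∈ meanSpace (C k)) {k : Fin K} (hk : 0 < gap θ k)
    (hnd : 0 < C k 0 0 → slope (C k) = rate (θ k) → 0 < residualVar (C k))
    {b : ℝ} (hb : b < sigmaSq θ C k / (θ k 0 * gap θ k)) :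
    ∀ᶠ B : ℝ in atTop, b * Real.log B ≤ gap θ k * θ k 0 * π.expPulls θ C B k := by
  have h0 : 0 < θ k 0 := (hθ k).1
  have hσ0 : 0 ≤ sigmaSq θ C k := add_nonneg (residualVar_nonneg (hC k))
    (mul_nonneg (sq_nonneg _) (hC k).diag_nonneg)
  rcases le_or_gt b 0 with hb0 | hb0
  · filter_upwards [eventually_ge_atTop 1] with B hB
    exact (mul_nonpos_of_nonpos_of_nonneg hb0 (Real.log_nonneg hB)).trans
      (mul_nonneg (by positivity) (π.expPulls_nonneg B k))
  have hσ : 0 < sigmaSq θ C k := by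
    refine hσ0.lt_of_ne' fun h => ?_
    rw [h, zero_div] at hb
    linarith
  set σ := sigmaSq θ C k
  set g := gap θ k * θ k 0 with hg
  have hg0 : 0 < g := mul_pos hk h0
  have hlt := mul_gap_lt_sigmaSq hC hθ hσ hk hnd
  -- At ε = 0 the right side is σ_k²/(E[X_k] Δ_k); ε absorbs both the exponent of consistency and
  -- the excess of u over its critical size.
  have hev1 : ∀ᶠ ε : ℝ in 𝓝[>] 0, b < (1 - ε) * σ / ((1 + ε) ^ 2 * g) := by
    have hc : ContinuousAt (fun ε : ℝ => (1 - ε) * σ / ((1 + ε) ^ 2 * g)) 0 :=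
      ContinuousAt.div (by fun_prop) (by fun_prop) (by simpa using hg0.ne')
    refine (hc.tendsto.mono_left nhdsWithin_le_nhds).eventually_const_lt ?_
    simpa [hg, mul_comm] using hb
  have hev2 : ∀ᶠ ε : ℝ in 𝓝[>] 0,
      (1 + ε) * ((bestRate θ - slope (C k)) * C k 0 0 * gap θ k) < σ := by
    have hc : Continuous fun ε : ℝ =>
      (1 + ε) * ((bestRate θ - slope (C k)) * C k 0 0 * gap θ k) := by fun_prop
    refine ((hc.tendsto 0).mono_left nhdsWithin_le_nhds).eventually_lt_const ?_
    simpa using hlt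
  obtain ⟨ε, ⟨h1, h2⟩, hε⟩ := ((hev1.and hev2).and self_mem_nhdsWithin).exists
  have hε : 0 < ε := hε
  -- Just above the critical size, so that arm `k` strictly beats the best rate.
  set u := (1 + ε) * g / σ
  have huσ : u * σ = (1 + ε) * g := div_mul_cancel₀ _ hσ.ne'
  obtain ⟨hmem, hbest⟩ := add_mulVec_mem_meanSpace hC hθ (k := k) (u := u)
    (by change g < u * σ; rw [huσ]; nlinarith) (by
      have : u * (bestRate θ - slope (C k)) * C k 0 0 =
          ((1 + ε) * ((bestRate θ - slope (C k)) * C k 0 0 * gap θ k)) / σ * θ k 0 := by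
        simp only [u, hg]
        ring
      rw [this]
      exact mul_lt_of_lt_one_left h0 ((div_lt_one hσ).2 h2))
  have hlog := π.eventually_log_le_integral_pulls hC hπ hθ hk
    (v := WithLp.toLp 2 ![-(u * bestRate θ), u]) hmem hbest hε
  simp only [dotProduct_mulVec_neg_bestRate (hC k)] at hlog
  change ∀ᶠ n : ℕ in atTop, (1 - ε) * Real.log n - 1 ≤ u ^ 2 * σ / 2 * _ at hlog
  obtain ⟨c, hc⟩ := π.exists_integral_pulls_le_expPulls hC (fun k => (hθ k).1)
  set D := u ^ 2 * σ / 2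
  have hu0 : 0 < u := by positivity
  have hD : 0 < D := by positivity
  -- In 2D, the 2 is the price of n ≈ √B and cancels the 1/2 in the information D per pull.
  have hgD : g * (1 - ε) / (2 * D) = (1 - ε) * σ / ((1 + ε) ^ 2 * g) := by
    have : 2 * D * σ = ((1 + ε) * g) ^ 2 := by
      rw [← huσ]
      simp only [D]
      ring
    rw [div_eq_div_iff (by positivity) (by positivity)]
    linear_combination -(1 - ε) * this
  rw [← hgD] at h1
  have hfloor : Tendsto (fun B : ℝ => ⌊√B⌋₊) atTop atTop :=
    tendsto_nat_floor_atTop.comp Real.tendsto_sqrt_atTop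
  have hbig : Tendsto (fun B : ℝ => (g * (1 - ε) / (2 * D) - b) * Real.log B) atTop atTop :=
    Real.tendsto_log_atTop.const_mul_atTop (sub_pos.2 h1)
  filter_upwards [hfloor.eventually hlog, hbig.eventually_ge_atTop
    (g / D * (|1 - ε| * Real.log 2 + 1) + g * c), eventually_ge_atTop 1] with B hB1 hB2 hB
  set n := ⌊√B⌋₊
  have hB0 : 0 < B := by linarith
  have hsq : 1 ≤ √B := Real.one_le_sqrt.2 hB
  have hn1 : (1 : ℝ) ≤ n := by exact_mod_cast Nat.le_floor (by simpa using hsq)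
  have hnle : (n : ℝ) ≤ √B := Nat.floor_le (by linarith)
  have hn2 : (n : ℝ) ^ 2 ≤ B := by
    calc (n : ℝ) ^ 2 ≤ √B ^ 2 := by gcongr
      _ = B := Real.sq_sqrt hB0.le
  -- Rounding √B ≥ 1 down at most halves it, a loss of log 2.
  have hlogn : Real.log B / 2 - Real.log 2 ≤ Real.log n := by
    have h3 : √B ≤ 2 * n := by linarith [Nat.lt_floor_add_one √B]
    have h4 := Real.log_le_log (by linarith) h3
    rw [Real.log_sqrt hB0.le, Real.log_mul (by norm_num) (by linarith)] at h4
    linarith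
  have hlogn' : Real.log n ≤ Real.log B / 2 := by
    rw [← Real.log_sqrt hB0.le]
    exact Real.log_le_log (by linarith) hnle
  have h5 := hc B n hB0 hn2 k
  have h6 : (1 - ε) * (Real.log B / 2) - |1 - ε| * Real.log 2 ≤ (1 - ε) * Real.log n := by
    have h7 : (1 - ε) * (Real.log B / 2 - Real.log n) ≤ |1 - ε| * Real.log 2 :=
      mul_le_mul (le_abs_self _) (by linarith) (by linarith) (abs_nonneg _)
    linarith
  have h8 : (1 - ε) * (Real.log B / 2) - |1 - ε| * Real.log 2 - 1 ≤
      D * (π.expPulls θ C B k + c) := by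
    have := mul_le_mul_of_nonneg_left (sub_le_iff_le_add.1 h5) hD.le
    linarith
  have h9 := mul_le_mul_of_nonneg_left h8 (div_pos hg0 hD).le
  have h10 : g / D * (D * (π.expPulls θ C B k + c)) = g * π.expPulls θ C B k + g * c := by
    field_simp
  have h11 : g / D * ((1 - ε) * (Real.log B / 2) - |1 - ε| * Real.log 2 - 1) =
      g * (1 - ε) / (2 * D) * Real.log B - g / D * (|1 - ε| * Real.log 2 + 1) := by
    field_simp
    ring
  rw [h10, h11] at h9
  linarith

/-- The policy that always pulls arm `k`. -/
def const (k : Fin K) : Policy K := ⟨fun _ _ => k, fun _ => measurable_const⟩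

/-- Charging every arm at the best rate isolates the loss as a cost-weighted count of suboptimal
pulls; what remains depends on the mean total cost alone. -/
theorem expReward_eq_bestRate (hC : ∀ k, (C k).PosSemidef) (hθ : ∀ k, 0 < θ k 0) (B : ℝ) :
    expReward θ C π B = bestRate θ * ∑ k, π.expPulls θ C B k * θ k 0 -
      ∑ k, gap θ k * θ k 0 * π.expPulls θ C B k := by
  rw [π.expReward_eq hC hθ, Finset.mul_sum, ← Finset.sum_sub_distrib]
  refine Finset.sum_congr rfl fun k _ => ?_
  rw [apply_one_eq (hθ k)]
  ring

/-- The optimal expected reward is at least the best rate times the budget. -/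
theorem bestRate_mul_le_iSup_expReward (hC : ∀ k, (C k).PosSemidef) (hθ : ∀ k, 0 < θ k 0)
    (hr : 0 ≤ bestRate θ) {B : ℝ} (hB : 0 < B) :
    bestRate θ * B ≤ ⨆ π' : Policy K, expReward θ C π' B := by
  obtain ⟨k, hk⟩ := exists_eq_ciSup_of_finite (f := fun i => rate (θ i))
  have hgk : gap θ k = 0 := sub_eq_zero.2 hk.symm
  refine le_trans ?_ (le_ciSup (bddAbove_expReward hC hθ hB) (const k))
  rw [expReward_eq_bestRate _ hC hθ, Finset.sum_eq_zero (s := Finset.univ)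
    (f := fun j => gap θ j * θ j 0 * (const k).expPulls θ C B j), sub_zero]
  · exact mul_le_mul_of_nonneg_left ((const k).le_sum_expPulls_mul hC hθ B) hr
  · intro j _
    by_cases hj : k = j
    · simp [← hj, hgk]
    · simp [expPulls, arm, const, hj]

/-- The regret is, up to `o(log B)`, at least the sum of the costs of the suboptimal pulls. -/
theorem eventually_sum_sub_le_regret (hC : ∀ k, (C k).PosSemidef) (hθ : ∀ k, 0 < θ k 0)
    (hr : 0 ≤ bestRate θ) {δ : ℝ} (hδ : 0 < δ) :
    ∀ᶠ B : ℝ in atTop, ∑ k, gap θ k * θ k 0 * π.expPulls θ C B k - δ * Real.log B ≤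
      π.regret θ C B := by
  obtain ⟨c, hc, hpulls⟩ := exists_sum_expPulls_le (C := C) hC hθ
  -- The overshoot is at most (2/t) log B for large B; this t makes r* times it at most δ log B, the
  -- added 1 keeping t positive when r* = 0.
  set t := 2 * (bestRate θ + 1) / δ
  have ht : 0 < t := by positivity
  obtain ⟨k₁, hk₁⟩ := Finite.exists_max fun k => Real.exp (θ k 0 * t + C k 0 0 * t ^ 2 / 2)
  set M := Real.exp (θ k₁ 0 * t + C k₁ 0 0 * t ^ 2 / 2)
  have hM : 0 < M := Real.exp_pos _
  filter_upwards [eventually_ge_atTop 1,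
    Real.tendsto_log_atTop.eventually_ge_atTop (2 * c * M)] with B hB hlog
  have hB0 : 0 < B := by linarith
  -- Taking a = B balances the O(B) bound on the pulls: the exponential term stays bounded and only
  -- log B remains.
  have h1 := π.sum_expPulls_mul_le hC hθ hB0 ht hB0
  have h2 : (∑ k, π.expPulls θ C B k * Real.exp (θ k 0 * t + C k 0 0 * t ^ 2 / 2)) / B ≤
      2 * c * M := by
    rw [div_le_iff₀ hB0]
    calc _ ≤ ∑ k, π.expPulls θ C B k * M := Finset.sum_le_sum fun k _ =>
          mul_le_mul_of_nonneg_left (hk₁ k) (π.expPulls_nonneg B k)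
      _ = (∑ k, π.expPulls θ C B k) * M := (Finset.sum_mul _ _ _).symm
      _ ≤ c * (B + 1) * M := mul_le_mul_of_nonneg_right (hpulls π B hB0) hM.le
      _ ≤ c * (2 * B) * M := by gcongr; linarith
      _ = _ := by ring
  have h3 : ∑ k, π.expPulls θ C B k * θ k 0 ≤ B + 1 / t * (2 * Real.log B) := by
    refine h1.trans ?_
    gcongr
    linarith
  have hlog0 : 0 ≤ Real.log B := Real.log_nonneg hB
  have h4 : bestRate θ * (1 / t * (2 * Real.log B)) ≤ δ * Real.log B := by
    have : bestRate θ * (1 / t * (2 * Real.log B)) =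
        bestRate θ / (bestRate θ + 1) * (δ * Real.log B) := by
      simp only [t]
      field_simp
    rw [this]
    exact mul_le_of_le_one_left (by positivity) ((div_le_one (by linarith)).2 (by linarith))
  have h5 := bestRate_mul_le_iSup_expReward hC hθ hr hB0
  have h6 := mul_le_mul_of_nonneg_left h3 hr
  rw [regret, π.expReward_eq_bestRate hC hθ]
  linarith

end Policy

end BudgetedBandit

/-! ### Assembly of the lower bound -/

theorem corollary1 (K : ℕ) [NeZero K]
    (C : Fin K → Matrix (Fin 2) (Fin 2) ℝ) (hC : ∀ k, (C k).PosSemidef)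
    (π : BudgetedBandit.Policy K) (hπ : π.IsConsistent C)
    (θ : Fin K → BudgetedBandit.Outcome) (hθ : ∀ k, θ k ∈ BudgetedBandit.meanSpace (C k))
    (hnd : ∀ k, 0 < BudgetedBandit.gap θ k → 0 < C k 0 0 →
      BudgetedBandit.slope (C k) = BudgetedBandit.rate (θ k) →
        0 < BudgetedBandit.residualVar (C k)) :
    (∀ B : ℝ, 0 < B →
      (∀ π' : BudgetedBandit.Policy K,
        Integrable (π'.reward B) (BudgetedBandit.law θ C)) ∧
      BddAbove (Set.range fun π' : BudgetedBandit.Policy K => π'.expReward θ C B)) ∧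
    ((∑ k with 0 < BudgetedBandit.gap θ k,
        BudgetedBandit.sigmaSq θ C k / (θ k 0 * BudgetedBandit.gap θ k) : ℝ) : EReal) ≤
      liminf (fun B : ℝ => ((π.regret θ C B / Real.log B : ℝ) : EReal)) atTop := by
  have hθ0 : ∀ k, 0 < θ k 0 := fun k => (hθ k).1
  have hr : 0 ≤ BudgetedBandit.bestRate θ :=
    (div_nonneg (hθ 0).2.1 (hθ 0).1.le).trans (BudgetedBandit.rate_le_bestRate θ 0)
  refine ⟨fun B hB => ⟨fun π' => π'.integrable_reward hC hθ0 B,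
    BudgetedBandit.Policy.bddAbove_expReward hC hθ0 hB⟩, ?_⟩
  set S := Finset.univ.filter fun k => 0 < BudgetedBandit.gap θ k
  set b : Fin K → ℝ := fun k => BudgetedBandit.sigmaSq θ C k / (θ k 0 * BudgetedBandit.gap θ k)
  refine le_of_forall_lt_imp_le_of_dense fun a ha => ?_
  obtain ⟨x, hax, hx⟩ := EReal.lt_iff_exists_real_btwn.1 ha
  refine hax.le.trans (le_liminf_of_le (by isBoundedDefault) ?_)
  have hx : x < ∑ k ∈ S, b k := EReal.coe_lt_coe_iff.1 hx
  -- The slack is shared equally: one δ for each suboptimal arm and one for the overshoot.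
  set δ := (∑ k ∈ S, b k - x) / (S.card + 1)
  have hδ : 0 < δ := div_pos (sub_pos.2 hx) (by positivity)
  have hδx : ∑ k ∈ S, (b k - δ) - δ = x := by
    have : δ * (S.card + 1) = ∑ k ∈ S, b k - x := div_mul_cancel₀ _ (by positivity)
    rw [Finset.sum_sub_distrib, Finset.sum_const, nsmul_eq_mul]
    linarith
  have harms : ∀ᶠ B : ℝ in atTop, ∀ k ∈ S, (b k - δ) * Real.log B ≤
      BudgetedBandit.gap θ k * θ k 0 * π.expPulls θ C B k := by
    rw [Filter.eventually_all_finset]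
    intro k hk
    have hk : 0 < BudgetedBandit.gap θ k := (Finset.mem_filter.1 hk).2
    exact π.eventually_mul_log_le_expPulls hC hπ hθ hk (hnd k hk) (sub_lt_self _ hδ)
  filter_upwards [harms, π.eventually_sum_sub_le_regret hC hθ0 hr hδ, eventually_gt_atTop 1]
    with B h1 h2 hB
  refine EReal.coe_le_coe_iff.2 ((le_div_iff₀ (Real.log_pos hB)).2 ?_)
  rw [← hδx, sub_mul, Finset.sum_mul]
  refine le_trans (sub_le_sub_right ?_ _) h2
  exact (Finset.sum_le_sum h1).trans (Finset.sum_le_sum_of_subset_of_nonneg (Finset.subset_univ _)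
    fun k _ _ => mul_nonneg (mul_nonneg (BudgetedBandit.gap_nonneg θ k) (hθ0 k).le)
      (π.expPulls_nonneg B k))
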